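/- Let $m\in\mathbb N$, let $A$ be a symmetric, irreducible $m\times m$ matrix with non-negative entries, and let $(w_{\mathbf n}(0))_{\mathbf n\in\mathbb N_0^m}$ be a monodisperse initial distribution: $w_{\mathbf n}(0)\ge 0$, $w_{\mathbf n}(0)\neq 0$ only for $\mathbf n$ a standard unit vector $\mathbf e_i$, and $\sum_{\mathbf n}|\mathbf n|w_{\mathbf n}(0)=1$. Put $p_i=w_{\mathbf e_i}(0)$, $P=\mathrm{diag}(p_1,\dots,p_m)$, $\mathbf m(0)=\sum_{\mathbf n}\mathbf n\,w_{\mathbf n}(0)$ and $U(0,\mathbf x)=\sum_{\mathbf n}w_{\mathbf n}(0)e^{-\mathbf x\cdot\mathbf n}$. For $t\ge 0$ let $\mathbf X_{k,(n,j)}$ ($k\in[m]$, $n,j\in\mathbb N_0$) be independent random vectors in $\mathbb N_0^m$, where for each type $k$ all copies have the generating function $G_{\mathbf X_k}(\mathbf s)=\prod_{l=1}^m\exp\big(tA_{kl}p_l(s_l-1)\big)$. Let $\mathbf Z_0=\mathbf e_i$, $\mathbf Z_{n+1}=\sum_{k=1}^m\sum_{j<Z_{n,k}}\mathbf X_{k,(n,j)}$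 be the multi-type branching process started from type $i$, let $\mathbf T^{(i)}=\sum_{n\ge 0}\mathbf Z_n\in(\mathbb N_0\cup\{\infty\})^m$ be its total progeny, and let $G_{\mathbf T^{(i)}}(\mathbf s)=\sum_{\mathbf n\in\mathbb N_0^m}\mathbb P(\mathbf T^{(i)}=\mathbf n)\,\mathbf s^{\mathbf n}$. Call the process critical if the matrix with entries $M_{kl}=\mathbb E[X_{k,l}]$ has spectral radius $1$. Put $T_c=1/\rho(AP)$, where $\rho$ is the spectral radius ($T_c=\infty$ if $\rho(AP)=0$). Define $$u_i(t,\mathbf x)=p_i\,G_{\mathbf T^{(i)}}(e^{-x_1},\dots,e^{-x_m}),\qquad i\in[m],\ t\ge 0,\ \mathbf x\in[0,\infty)^m .$$ Then: (1) $\mathbf u$ solves $\partial_t\mathbf u=-(\nabla\mathbf u)\,A\,(\mathbf u-\mathbf m(0))$ for $t\in[0,T_c)$, $\mathbf x\in[0,\infty)^m$, where $\nabla\mathbf u$ is the Jacobian matrix in $\mathbf x$ and derivatives are one-sided at the boundary, with initial condition $\mathbf u(0,\mathbf x)=-\nabla U(0,\mathbf x)$. (2) $\mathbf u$ is smooth (infinitely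 differentiable, jointly in $(t,\mathbf x)$) on $[0,T_c)\times[0,\infty)^m$, and if $T_c<\infty$, then $\mathbf u(T_c,\cdot)$ is not differentiable at $\mathbf x=\mathbf 0$. (3) $T_c$ is the critical time: for $t\ge 0$ the process is critical if and only if $t=T_c$. Moreover $T_c>0$ and $T_c\ge\|AP\|_2^{-1}$, where $\|\cdot\|_2$ is the Euclidean operator norm. -/

import Mathlib

open MeasureTheory ProbabilityTheory
open scoped ENNReal Matrix

noncomputable section

namespace Coagulation

/-! ### Initial distribution -/

/-- The total mass vector `∑ₙ n wₙ` of a family `w` indexed by `ℕ₀^m`. -/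
def massVector {m : ℕ} (w : (Fin m → ℕ) → ℝ) : Fin m → ℝ :=
  fun i => ∑' n : Fin m → ℕ, (n i : ℝ) * w n

/-- The generating function `U(x) = ∑ₙ wₙ e^{-x·n}`. -/
def genFun {m : ℕ} (w : (Fin m → ℕ) → ℝ) (x : Fin m → ℝ) : ℝ :=
  ∑' n : Fin m → ℕ, w n * Real.exp (-∑ j, x j * (n j : ℝ))

/-- Monodisperse initial conditions: non-negative, of total mass `∑ₙ |n| wₙ = 1`,
and supported on the standard unit vectors. -/
structure IsMonodisperse {m : ℕ} (w : (Fin m → ℕ) → ℝ) : Prop where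
  nonneg : ∀ n, 0 ≤ w n
  mass : HasSum (fun n : Fin m → ℕ => (∑ i, (n i : ℝ)) * w n) 1
  support : ∀ n, w n ≠ 0 → ∃ i : Fin m, n = Pi.single i 1

/-! ### Multi-type branching processes -/

/-- The probability generating function of a random vector with values in `ℕ ∪ {∞}`,
`G_T(s) = ∑_{n ∈ ℕ₀^m} P(T = n) s^n` (the event that `T` has an infinite component does
not contribute). -/
def pgf {m : ℕ} {Ω : Type*} [MeasurableSpace Ω] (μ : Measure Ω) (T : Ω → Fin m → ℕ∞)
    (s : Fin m → ℝ) : ℝ :=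
  ∑' n : Fin m → ℕ, μ.real {ω | ∀ i, T ω i = (n i : ℕ∞)} * ∏ i, s i ^ n i

/-- The generations of the multi-type branching process started from type `i`:
`Z₀ = e_i` and `Z_{n+1} = ∑_k ∑_{j < Z_{n,k}} X_{k,(n,j)}`. -/
def generation {m : ℕ} {Ω : Type*} (X : Fin m → ℕ → ℕ → Ω → Fin m → ℕ) (i : Fin m) :
    ℕ → Ω → Fin m → ℕ
  | 0, _ => Pi.single i 1
  | n + 1, ω => ∑ k, ∑ j ∈ Finset.range (generation X i n ω k), X k n j ω

/-- The total progeny `T^{(i)} = ∑ₙ Zₙ`, with values in `ℕ ∪ {∞}` (the infinite sum is the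
supremum of its partial sums). -/
def totalProgeny {m : ℕ} {Ω : Type*} (X : Fin m → ℕ → ℕ → Ω → Fin m → ℕ) (i : Fin m) :
    Ω → Fin m → ℕ∞ :=
  fun ω l => ⨆ N : ℕ, ∑ n ∈ Finset.range N, (generation X i n ω l : ℕ∞)

/-- `X` is a family of offspring vectors `X_{k,(n,j)}`: independent, and for each type `k`
all the copies `X_{k,(n,j)}` have the distribution on `ℕ₀^m` with generating function `G k`. -/
structure IsOffspringFamily {m : ℕ} {Ω : Type*} [MeasurableSpace Ω] (μ : Measure Ω)
    (X : Fin m → ℕ → ℕ → Ω → Fin m → ℕ) (G : Fin m → (Fin m → ℝ) → ℝ) : Prop where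
  measurable : ∀ k n j, Measurable (X k n j)
  indep : iIndepFun (fun q : Fin m × ℕ × ℕ => X q.1 q.2.1 q.2.2) μ
  pgf_eq : ∀ k n j, ∀ s : Fin m → ℝ, (∀ l, 0 ≤ s l ∧ s l ≤ 1) →
    pgf μ (fun ω l => (X k n j ω l : ℕ∞)) s = G k s

/-- The Poisson offspring generating functions `G_{X_k}(s) = ∏_l exp(t A_{kl} p_l (s_l - 1))`. -/
def poissonOffspring {m : ℕ} (A : Matrix (Fin m) (Fin m) ℝ) (p : Fin m → ℝ) (t : ℝ)
    (k : Fin m) (s : Fin m → ℝ) : ℝ :=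
  ∏ l, Real.exp (t * A k l * p l * (s l - 1))

/-- The matrix of mean offspring numbers, `M_{kl} = E[X_{k,l}]`. -/
def meanMatrix {m : ℕ} {Ω : Type*} [MeasurableSpace Ω] (μ : Measure Ω)
    (X : Fin m → ℕ → ℕ → Ω → Fin m → ℕ) : Matrix (Fin m) (Fin m) ℝ :=
  Matrix.of fun k l => ∫ ω, (X k 0 0 ω l : ℝ) ∂μ

/-- The spectral radius of a real matrix: the largest modulus of its complex eigenvalues. -/
def specRadius {m : ℕ} (M : Matrix (Fin m) (Fin m) ℝ) : ℝ≥0∞ :=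
  spectralRadius ℂ (M.map (algebraMap ℝ ℂ))

/-- A branching process is critical if its mean matrix has spectral radius one. -/
def IsCritical {m : ℕ} {Ω : Type*} [MeasurableSpace Ω] (μ : Measure Ω)
    (X : Fin m → ℕ → ℕ → Ω → Fin m → ℕ) : Prop :=
  specRadius (meanMatrix μ X) = 1

/-- The critical time `1 / ρ(A P)`, `P = diag(p)`; it is `∞` if `ρ(A P) = 0`. -/
def criticalTime {m : ℕ} (A : Matrix (Fin m) (Fin m) ℝ) (p : Fin m → ℝ) : ℝ≥0∞ :=
  (specRadius (A * Matrix.diagonal p))⁻¹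

/-! ### The candidate solution and the equation -/

/-- `u_i(t, x) = p_i G_{T^{(i)}}(e^{-x_1}, …, e^{-x_m})`, for the process with offspring `X t`
on the probability space `(Ω t, μ t)`. -/
def solution {m : ℕ} {Ω : ℝ → Type*} [∀ t, MeasurableSpace (Ω t)] (μ : ∀ t, Measure (Ω t))
    (X : ∀ t, Fin m → ℕ → ℕ → Ω t → Fin m → ℕ) (p : Fin m → ℝ) (t : ℝ) (x : Fin m → ℝ) :
    Fin m → ℝ :=
  fun i => p i * pgf (μ t) (totalProgeny (X t) i) (fun j => Real.exp (-x j))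

/-- The closed orthant `[0,∞)^m`. -/
def orthant (m : ℕ) : Set (Fin m → ℝ) := {x | ∀ i, 0 ≤ x i}

/-- `∂ₜ u = -(∇u) A (u - m₀)` holds at `(t, x)`, where `∇u` is the Jacobian matrix of `u`
in `x`; the derivatives are taken within the domain `[0,∞) × [0,∞)^m`, hence one-sided at its
boundary. -/
def SolvesBurgersAt {m : ℕ} (A : Matrix (Fin m) (Fin m) ℝ) (m₀ : Fin m → ℝ)
    (u : ℝ → (Fin m → ℝ) → Fin m → ℝ) (t : ℝ) (x : Fin m → ℝ) : Prop :=
  ∃ J : Matrix (Fin m) (Fin m) ℝ,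
    HasFDerivWithinAt (u t) (LinearMap.toContinuousLinearMap J.mulVecLin) (orthant m) x ∧
    HasDerivWithinAt (fun s => u s x) (-(J *ᵥ (A *ᵥ (u t x - m₀)))) (Set.Ici 0) t

/-- `v = -∇U` at `x`, as a derivative within `[0,∞)^m`. -/
def IsNegGradientAt {m : ℕ} (U : (Fin m → ℝ) → ℝ) (v x : Fin m → ℝ) : Prop :=
  HasFDerivWithinAt U
    (-∑ i, v i • ContinuousLinearMap.proj (R := ℝ) (φ := fun _ : Fin m => ℝ) i) (orthant m) x

end Coagulation

end

namespace Coagulation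

/-! ### The spectral radius of a symmetrizable matrix -/

section SpectralRadius

variable {m : ℕ}

/-! With `s = e^{-x}`, the progeny generating functions `h` satisfy `h_i = exp(-x_i + t ∑ A_il p_l
(h_l - 1))` (`pgf_totalProgeny_eq_progenyMap`): conditioning generation by generation identifies the
iterates of `v ↦ s G(v)` with generating functions of truncated progenies, and the truncation is
then removed. The analytic claims follow from this equation and `0 ≤ h ≤ 1`.

Linearising in `h` gives `1 - t diag(h) A P`. As `A P` has the spectral radius of the symmetric
matrix `P^{1/2} A P^{1/2}`, a quadratic form estimate makes this injective whenever `t ρ(A P) < 1`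
(`eq_zero_of_eq_mul_mulVec`). The implicit function theorem gives a smooth local branch, and a
contraction-type uniqueness argument identifies it with `h`. The derivative of `h` in the direction
`(1, A(u - p))` solves the homogeneous linearised equation, so it vanishes: this is the Burgers
equation, in characteristic form.

When `t ρ(A P) = 1`, a non-negative left eigenvector `φ` of `A P` satisfies `t φ A P = φ`. If `u`
were differentiable at `0`, differentiating `∑ φ_i (h_i - 1)` along the diagonal in two ways would
give values differing by `∑ φ_i > 0`. Finally the mean matrix is `t A P`, so criticality means `t
ρ(A P) = 1`; the norm bound comes from a real eigenvector of `A P` with eigenvalue `ρ(A P)`. -/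

theorem exists_mem_spectrum_enorm_eq_specRadius [NeZero m] (M : Matrix (Fin m) (Fin m) ℝ) :
    ∃ k ∈ spectrum ℂ (M.map (algebraMap ℝ ℂ)), ‖k‖ₑ = specRadius M := by
  -- Any complete algebra norm will do: the spectral radius is defined from the spectrum alone.
  let : NormedRing (Matrix (Fin m) (Fin m) ℂ) := Matrix.linftyOpNormedRing
  let : NormedAlgebra ℂ (Matrix (Fin m) (Fin m) ℂ) := Matrix.linftyOpNormedAlgebra
  have : CompleteSpace (Matrix (Fin m) (Fin m) ℂ) := FiniteDimensional.complete ℂ _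
  exact spectrum.exists_nnnorm_eq_spectralRadius (M.map (algebraMap ℝ ℂ))

theorem enorm_le_specRadius {M : Matrix (Fin m) (Fin m) ℝ} {k : ℂ}
    (hk : k ∈ spectrum ℂ (M.map (algebraMap ℝ ℂ))) : ‖k‖ₑ ≤ specRadius M :=
  le_iSup₂ (f := fun (k : ℂ) (_ : k ∈ spectrum ℂ (M.map (algebraMap ℝ ℂ))) => (‖k‖₊ : ℝ≥0∞)) k hk

theorem specRadius_ne_top [NeZero m] (M : Matrix (Fin m) (Fin m) ℝ) : specRadius M ≠ ⊤ := by
  obtain ⟨k, -, hk⟩ := exists_mem_spectrum_enorm_eq_specRadius M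
  rw [← hk]
  exact enorm_ne_top

/-- The spectra of `M N` and `N M` agree away from `0`, and `0` does not affect the supremum of
moduli. -/
theorem specRadius_mul_comm (M N : Matrix (Fin m) (Fin m) ℝ) :
    specRadius (M * N) = specRadius (N * M) := by
  have key : ∀ a b : Matrix (Fin m) (Fin m) ℂ,
      spectralRadius ℂ (a * b) ≤ spectralRadius ℂ (b * a) := by
    intro a b
    refine iSup₂_le fun k hk => ?_
    by_cases h0 : k = 0
    · simp [h0]
    have : k ∈ spectrum ℂ (b * a) \ {0} := by
      rw [← spectrum.nonzero_mul_comm]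
      exact ⟨hk, h0⟩
    exact le_iSup₂ (f := fun (k : ℂ) (_ : k ∈ spectrum ℂ (b * a)) => (‖k‖₊ : ℝ≥0∞)) k this.1
  unfold specRadius
  rw [Matrix.map_mul, Matrix.map_mul]
  exact le_antisymm (key _ _) (key _ _)

theorem specRadius_smul [NeZero m] {c : ℝ} (hc : 0 ≤ c) (M : Matrix (Fin m) (Fin m) ℝ) :
    specRadius (c • M) = ENNReal.ofReal c * specRadius M := by
  have hmap : (c • M).map (algebraMap ℝ ℂ) = (c : ℂ) • M.map (algebraMap ℝ ℂ) := by
    ext i j; simp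
  have hne : (spectrum ℂ (M.map (algebraMap ℝ ℂ))).Nonempty :=
    let ⟨k, hk, _⟩ := exists_mem_spectrum_enorm_eq_specRadius M
    ⟨k, hk⟩
  have hcn : ‖(c : ℂ)‖ₑ = ENNReal.ofReal c := by
    rw [← ofReal_norm, Complex.norm_real, Real.norm_of_nonneg hc]
  apply le_antisymm
  · obtain ⟨k, hk, hk'⟩ := exists_mem_spectrum_enorm_eq_specRadius (c • M)
    rw [hmap, spectrum.smul_eq_smul _ _ hne] at hk
    obtain ⟨l, hl, rfl⟩ := hk
    rw [← hk']
    simp only [smul_eq_mul, enorm_mul, hcn]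
    gcongr
    exact enorm_le_specRadius hl
  · obtain ⟨k, hk, hk'⟩ := exists_mem_spectrum_enorm_eq_specRadius M
    rw [← hk', ← hcn, ← enorm_mul]
    apply enorm_le_specRadius
    rw [hmap, spectrum.smul_eq_smul _ _ hne]
    exact ⟨k, hk, rfl⟩

/-- The quadratic form of a real symmetric matrix is bounded by its spectral radius. -/
theorem posSemidef_specRadius_sub [NeZero m] {S : Matrix (Fin m) (Fin m) ℝ} (hS : S.IsSymm) :
    ((specRadius S).toReal • (1 : Matrix (Fin m) (Fin m) ℝ) - S).PosSemidef := by
  rw [Matrix.posSemidef_iff_isHermitian_and_spectrum_nonneg]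
  refine ⟨?_, ?_⟩
  · rw [Matrix.IsHermitian, Matrix.conjTranspose_eq_transpose_of_trivial]
    simp [hS.eq]
  intro a ha
  set r := (specRadius S).toReal
  have h1 : r - a ∈ spectrum ℝ S := by
    rw [spectrum.mem_iff] at ha ⊢
    intro hu
    apply ha
    have := hu.neg
    convert this using 1
    rw [Algebra.algebraMap_eq_smul_one, Algebra.algebraMap_eq_smul_one, sub_smul]
    abel
  have h2 : ((r - a : ℝ) : ℂ) ∈ spectrum ℂ (S.map (algebraMap ℝ ℂ)) := by
    rw [spectrum.mem_iff, Matrix.isUnit_iff_isUnit_det, isUnit_iff_ne_zero, not_not] at h1 ⊢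
    have : algebraMap ℂ (Matrix (Fin m) (Fin m) ℂ) ((r - a : ℝ) : ℂ) - S.map (algebraMap ℝ ℂ)
        = (algebraMap ℝ ℂ).mapMatrix (algebraMap ℝ (Matrix (Fin m) (Fin m) ℝ) (r - a) - S) := by
      ext i j
      by_cases hij : i = j <;>
        simp [Algebra.algebraMap_eq_smul_one, hij]
    rw [this, ← RingHom.map_det, h1, map_zero]
  have h3 := enorm_le_specRadius h2
  have h4 : |r - a| ≤ r := by
    have := ENNReal.toReal_mono (specRadius_ne_top S) h3
    rwa [toReal_enorm, Complex.norm_real] at this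
  have := (abs_le.1 h4).2
  show 0 ≤ a
  linarith

theorem dotProduct_mulVec_le [NeZero m] {S : Matrix (Fin m) (Fin m) ℝ} (hS : S.IsSymm)
    (y : Fin m → ℝ) : y ⬝ᵥ (S *ᵥ y) ≤ (specRadius S).toReal * (y ⬝ᵥ y) := by
  have := (posSemidef_specRadius_sub hS).dotProduct_mulVec_nonneg y
  simp only [star_trivial, Matrix.sub_mulVec, Matrix.smul_mulVec, Matrix.one_mulVec,
    dotProduct_sub, dotProduct_smul, smul_eq_mul] at this
  linarith

/-- Perron's theorem for symmetric matrices with non-negative entries. -/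
theorem exists_nonneg_eigenvector [NeZero m] {S : Matrix (Fin m) (Fin m) ℝ} (hS : S.IsSymm)
    (hS0 : ∀ i j, 0 ≤ S i j) :
    ∃ z : Fin m → ℝ, (∀ i, 0 ≤ z i) ∧ z ≠ 0 ∧ S *ᵥ z = (specRadius S).toReal • z := by
  obtain ⟨k, hk, hk'⟩ := exists_mem_spectrum_enorm_eq_specRadius S
  have hkr : ‖k‖ = (specRadius S).toReal := by rw [← hk']; simp
  rw [spectrum.mem_iff, Matrix.isUnit_iff_isUnit_det, isUnit_iff_ne_zero, not_not,
    ← Matrix.exists_mulVec_eq_zero_iff] at hk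
  obtain ⟨y, hy0, hy⟩ := hk
  have hy' : ∀ i, k * y i = ∑ j, (S i j : ℂ) * y j := by
    intro i
    have := congrFun hy i
    rw [Matrix.sub_mulVec, Algebra.algebraMap_eq_smul_one, Matrix.smul_mulVec,
      Matrix.one_mulVec] at this
    simpa [Matrix.mulVec, dotProduct, sub_eq_zero] using this
  -- The triangle inequality turns an eigenvector of maximal modulus into a subsolution `r |y| ≤ S
  -- |y|`.
  have hz : ∀ i, (specRadius S).toReal * ‖y i‖ ≤ (S *ᵥ fun i => ‖y i‖) i := by
    intro i
    rw [← hkr, ← norm_mul, hy']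
    refine (norm_sum_le _ _).trans (le_of_eq ?_)
    simp only [Matrix.mulVec, dotProduct]
    refine Finset.sum_congr rfl fun j _ => ?_
    rw [norm_mul, Complex.norm_real, Real.norm_of_nonneg (hS0 i j)]
  refine ⟨fun i => ‖y i‖, fun i => norm_nonneg _, ?_, ?_⟩
  · intro h
    apply hy0
    ext i
    exact norm_eq_zero.1 (congrFun h i)
  · have hpsd := posSemidef_specRadius_sub hS
    set z : Fin m → ℝ := fun i => ‖y i‖
    set r := (specRadius S).toReal
    have h1 : r * (z ⬝ᵥ z) ≤ z ⬝ᵥ (S *ᵥ z) := by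
      simp only [dotProduct, Finset.mul_sum]
      refine Finset.sum_le_sum fun i _ => ?_
      have := mul_le_mul_of_nonneg_left (hz i) (norm_nonneg (y i))
      calc r * (z i * z i) = ‖y i‖ * (r * ‖y i‖) := by simp only [z]; ring
        _ ≤ _ := this
    -- The positive semidefinite form of `r - S` vanishes at `z`, so `z` lies in its kernel.
    have h2 : star z ⬝ᵥ ((r • (1 : Matrix (Fin m) (Fin m) ℝ) - S) *ᵥ z) = 0 := by
      simp only [star_trivial, Matrix.sub_mulVec, Matrix.smul_mulVec, Matrix.one_mulVec,
        dotProduct_sub, dotProduct_smul, smul_eq_mul]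
      have := dotProduct_mulVec_le hS z
      linarith
    rw [hpsd.dotProduct_mulVec_zero_iff] at h2
    rw [Matrix.sub_mulVec, Matrix.smul_mulVec, Matrix.one_mulVec, sub_eq_zero] at h2
    exact h2.symm

/-- The symmetric matrix `P^{1/2} A P^{1/2}`, where `P = diag p`. -/
noncomputable def symmetrization (A : Matrix (Fin m) (Fin m) ℝ) (p : Fin m → ℝ) : Matrix (Fin m) (Fin m) ℝ :=
  Matrix.of fun i j => √(p i) * A i j * √(p j)

variable {A : Matrix (Fin m) (Fin m) ℝ} {p : Fin m → ℝ}

theorem symmetrization_isSymm (hA : A.IsSymm) : (symmetrization A p).IsSymm := by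
  ext i j
  simp only [Matrix.transpose_apply, symmetrization, Matrix.of_apply, hA.apply i j]
  ring

theorem symmetrization_nonneg (hA0 : ∀ i j, 0 ≤ A i j) (i j : Fin m) :
    0 ≤ symmetrization A p i j :=
  mul_nonneg (mul_nonneg (Real.sqrt_nonneg _) (hA0 i j)) (Real.sqrt_nonneg _)

/-- Since some `p i` may vanish, this is not a similarity; instead `P^{1/2}` is moved cyclically
from the left factor to the right. -/
theorem specRadius_symmetrization (hp : ∀ i, 0 ≤ p i) :
    specRadius (symmetrization A p) = specRadius (A * Matrix.diagonal p) := by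
  have h1 : symmetrization A p
      = Matrix.diagonal (fun i => √(p i)) * (A * Matrix.diagonal fun i => √(p i)) := by
    ext i j
    simp [symmetrization, Matrix.diagonal_mul, Matrix.mul_diagonal, mul_assoc]
  have h2 : A * Matrix.diagonal p
      = (A * Matrix.diagonal fun i => √(p i)) * Matrix.diagonal (fun i => √(p i)) := by
    rw [Matrix.mul_assoc, Matrix.diagonal_mul_diagonal]
    congr 2
    ext i
    exact (Real.mul_self_sqrt (hp i)).symm
  rw [h1, h2, specRadius_mul_comm]

/-- A non-negative vector with `v ≤ c A P v` vanishes if `c ρ(A P) < 1`. -/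
theorem eq_zero_of_le_mulVec [NeZero m] (hA : A.IsSymm)
    (hp : ∀ i, 0 ≤ p i) {c : ℝ} (hc : 0 ≤ c)
    (hcr : c * (specRadius (A * Matrix.diagonal p)).toReal < 1) {v : Fin m → ℝ}
    (hv : ∀ i, 0 ≤ v i) (hle : ∀ i, v i ≤ c * ∑ l, A i l * p l * v l) : v = 0 := by
  rw [← specRadius_symmetrization hp] at hcr
  -- In the variable `y = P^{1/2} v` the bound reads `y ≤ c S y` with `S` symmetric; pairing with `y
  -- ≥ 0` gives `|y|² ≤ c ρ |y|²`.
  set y : Fin m → ℝ := fun i => √(p i) * v i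
  have hy : ∀ i, y i ≤ c * (symmetrization A p *ᵥ y) i := by
    intro i
    have := mul_le_mul_of_nonneg_left (hle i) (Real.sqrt_nonneg (p i))
    refine this.trans (le_of_eq ?_)
    simp only [Matrix.mulVec, dotProduct, symmetrization, Matrix.of_apply, Finset.mul_sum, y]
    refine Finset.sum_congr rfl fun l _ => ?_
    nth_rw 1 [← Real.mul_self_sqrt (hp l)]
    ring
  have h1 : y ⬝ᵥ y ≤ c * (y ⬝ᵥ (symmetrization A p *ᵥ y)) := by
    simp only [dotProduct, Finset.mul_sum]
    refine Finset.sum_le_sum fun i _ => ?_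
    have := mul_le_mul_of_nonneg_left (hy i) (mul_nonneg (Real.sqrt_nonneg (p i)) (hv i))
    linarith
  have h2 := mul_le_mul_of_nonneg_left
    (dotProduct_mulVec_le (symmetrization_isSymm (p := p) hA) y) hc
  have h3 : 0 ≤ y ⬝ᵥ y := by
    simp only [dotProduct]
    exact Finset.sum_nonneg fun i _ => mul_self_nonneg _
  have h4 : y ⬝ᵥ y = 0 := by
    by_contra hne
    have hpos : 0 < y ⬝ᵥ y := lt_of_le_of_ne h3 (Ne.symm hne)
    nlinarith
  have h5 : y = 0 := dotProduct_self_eq_zero.1 h4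
  ext i
  -- `y = 0` kills `v l` only where `p l > 0`, but those are the only entries seen by `A P v`, which
  -- dominates all of `v`.
  refine le_antisymm ((hle i).trans (le_of_eq ?_)) (hv i)
  have : ∀ l, A i l * p l * v l = 0 := by
    intro l
    have hl : √(p l) * v l = 0 := congrFun h5 l
    rw [← Real.mul_self_sqrt (hp l)]
    linear_combination A i l * √(p l) * hl
  simp [this]

/-- `A P` has a non-negative left eigenvector for its spectral radius. -/
theorem exists_nonneg_left_eigenvector [NeZero m] (hA : A.IsSymm) (hA0 : ∀ i j, 0 ≤ A i j)
    (hp : ∀ i, 0 ≤ p i) (hr : 0 < (specRadius (A * Matrix.diagonal p)).toReal) :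
    ∃ φ : Fin m → ℝ, (∀ i, 0 ≤ φ i) ∧ φ ≠ 0 ∧
      ∀ l, ∑ i, φ i * (A i l * p l) = (specRadius (A * Matrix.diagonal p)).toReal * φ l := by
  obtain ⟨z, hz0, hz, hSz⟩ := exists_nonneg_eigenvector (symmetrization_isSymm (p := p) hA)
    (symmetrization_nonneg hA0)
  rw [specRadius_symmetrization hp] at hSz
  set r := (specRadius (A * Matrix.diagonal p)).toReal
  have hSz' : ∀ l, ∑ i, √(p l) * A l i * √(p i) * z i = r * z l := fun l => congrFun hSz l
  refine ⟨fun i => √(p i) * z i, fun i => mul_nonneg (Real.sqrt_nonneg _) (hz0 i), ?_, ?_⟩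
  · intro h
    apply hz
    ext l
    have h1 := hSz' l
    have : ∀ i, √(p l) * A l i * √(p i) * z i = 0 := fun i => by
      have hi : √(p i) * z i = 0 := congrFun h i
      linear_combination √(p l) * A l i * hi
    simp only [this, Finset.sum_const_zero] at h1
    simpa [hr.ne'] using h1.symm
  · intro l
    have := congrArg (√(p l) * ·) (hSz' l)
    simp only [Finset.mul_sum] at this
    rw [show r * (√(p l) * z l) = √(p l) * (r * z l) by ring, ← this]
    refine Finset.sum_congr rfl fun i _ => ?_
    rw [hA.apply i l]
    linear_combination -√(p i) * z i * A i l * Real.mul_self_sqrt (hp l)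

theorem specRadius_mul_diagonal_le [NeZero m] (hA : A.IsSymm) (hA0 : ∀ i j, 0 ≤ A i j)
    (hp : ∀ i, 0 ≤ p i) :
    specRadius (A * Matrix.diagonal p)
      ≤ ‖Matrix.toEuclideanCLM (𝕜 := ℝ) (A * Matrix.diagonal p)‖ₑ := by
  obtain ⟨z, hz0, hz, hSz⟩ := exists_nonneg_eigenvector (symmetrization_isSymm (p := p) hA)
    (symmetrization_nonneg hA0)
  rw [specRadius_symmetrization hp] at hSz
  rw [← ENNReal.ofReal_toReal (specRadius_ne_top (A * Matrix.diagonal p)), ← ofReal_norm]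
  apply ENNReal.ofReal_le_ofReal
  set r := (specRadius (A * Matrix.diagonal p)).toReal
  have hr0 : 0 ≤ r := ENNReal.toReal_nonneg
  rcases hr0.eq_or_lt with hr | hr
  · rw [← hr]; exact norm_nonneg _
  have hSz' : ∀ l, ∑ i, √(p l) * A l i * √(p i) * z i = r * z l := fun l => congrFun hSz l
  -- If `S z = r z`, then `v = A P^{1/2} z` is an eigenvector of `A P` for `r`; it is non-zero
  -- because `P^{1/2} v = r z` and `r > 0`.
  set v : Fin m → ℝ := fun i => ∑ l, A i l * √(p l) * z l
  have hv : ∀ i, √(p i) * v i = r * z i := fun i => by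
    rw [← hSz' i, Finset.mul_sum]
    exact Finset.sum_congr rfl fun l _ => by ring
  have hv0 : v ≠ 0 := by
    intro h
    apply hz
    ext i
    have := hv i
    rw [h] at this
    simpa [hr.ne'] using this.symm
  have hev : (A * Matrix.diagonal p) *ᵥ v = r • v := by
    ext i
    simp only [Matrix.mulVec, dotProduct, Matrix.mul_diagonal, Pi.smul_apply, smul_eq_mul]
    rw [show r * v i = ∑ l, A i l * √(p l) * (r * z l) by
      simp only [v, Finset.mul_sum]
      exact Finset.sum_congr rfl fun l _ => by ring]
    refine Finset.sum_congr rfl fun l _ => ?_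
    rw [← hv l]
    nth_rw 1 [← Real.mul_self_sqrt (hp l)]
    ring
  have h1 := (Matrix.toEuclideanCLM (𝕜 := ℝ) (A * Matrix.diagonal p)).le_opNorm
    (WithLp.toLp 2 v)
  rw [Matrix.toEuclideanCLM_toLp, hev, WithLp.toLp_smul, norm_smul, Real.norm_of_nonneg hr0] at h1
  refine le_of_mul_le_mul_right h1 (norm_pos_iff.2 ?_)
  simpa using hv0

end SpectralRadius

end Coagulation

namespace Coagulation

/-! ### The fixed point equation of the total progeny -/

section FixedPoint

open Filter Topology

variable {m : ℕ}

/-- The map whose fixed points `h` are the candidates for the generating functions of the total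
progeny at time `t` and `s = e^{-x}`. -/
noncomputable def progenyMap (A : Matrix (Fin m) (Fin m) ℝ) (p : Fin m → ℝ) (t : ℝ)
    (x h : Fin m → ℝ) : Fin m → ℝ :=
  fun i => Real.exp (-x i + t * ∑ l, A i l * p l * (h l - 1))

variable {A : Matrix (Fin m) (Fin m) ℝ} {p : Fin m → ℝ}

theorem contDiff_progenyMap {n : WithTop ℕ∞} : ContDiff ℝ n
    (fun v : (ℝ × (Fin m → ℝ)) × (Fin m → ℝ) => progenyMap A p v.1.1 v.1.2 v.2) := by
  unfold progenyMap
  fun_prop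

/-- All three arguments vary so that one formula serves both the linearisation in `h` at fixed `(t,
x)` and the derivative along a branch `g (t, x)`. -/
theorem hasFDerivAt_progenyMap_comp {E : Type*} [NormedAddCommGroup E] [NormedSpace ℝ E]
    {τ : E → ℝ} {ξ g : E → Fin m → ℝ} {τ' : E →L[ℝ] ℝ} {ξ' g' : E →L[ℝ] Fin m → ℝ} {q : E}
    (hτ : HasFDerivAt τ τ' q) (hξ : HasFDerivAt ξ ξ' q) (hg : HasFDerivAt g g' q) :
    ∃ L : E →L[ℝ] Fin m → ℝ, HasFDerivAt (fun y => progenyMap A p (τ y) (ξ y) (g y)) L q ∧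
      ∀ e i, L e i = progenyMap A p (τ q) (ξ q) (g q) i *
        (-ξ' e i + τ' e * ∑ l, A i l * p l * (g q l - 1) + τ q * ∑ l, A i l * p l * g' e l) := by
  have hg' := hasFDerivAt_pi'.1 hg
  have hξ' := hasFDerivAt_pi'.1 hξ
  have hS : ∀ i, HasFDerivAt (fun y => ∑ l, A i l * p l * (g y l - 1))
      (∑ l, (A i l * p l) • ((ContinuousLinearMap.proj l).comp g')) q := fun i =>
    HasFDerivAt.fun_sum fun l _ => ((hg' l).sub_const 1).const_mul _
  refine ⟨_, hasFDerivAt_pi.2 fun i => ((hξ' i).neg.add (hτ.mul (hS i))).exp, fun e i => ?_⟩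
  simp [progenyMap]
  ring

/-- Taking absolute values reduces to the subsolution estimate, as `0 ≤ c ≤ 1`. With `c = h` this
says that the linearised fixed point equation has trivial kernel. -/
theorem eq_zero_of_eq_mul_mulVec [NeZero m] (hA : A.IsSymm) (hA0 : ∀ i j, 0 ≤ A i j)
    (hp : ∀ i, 0 ≤ p i) {t : ℝ} (ht : 0 ≤ t)
    (htr : t * (specRadius (A * Matrix.diagonal p)).toReal < 1) {c v : Fin m → ℝ}
    (hc0 : ∀ i, 0 ≤ c i) (hc1 : ∀ i, c i ≤ 1)
    (hv : ∀ i, v i = c i * (t * ∑ l, A i l * p l * v l)) : v = 0 := by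
  have : (fun i => |v i|) = 0 := by
    refine eq_zero_of_le_mulVec hA hp ht htr (fun i => abs_nonneg _) fun i => ?_
    rw [hv i, abs_mul, abs_mul, abs_of_nonneg (hc0 i), abs_of_nonneg ht]
    calc c i * (t * |∑ l, A i l * p l * v l|)
        ≤ 1 * (t * |∑ l, A i l * p l * v l|) := by
          gcongr
          exact hc1 i
      _ = t * |∑ l, A i l * p l * v l| := one_mul _
      _ ≤ t * ∑ l, |A i l * p l * v l| := by
          gcongr
          exact Finset.abs_sum_le_sum_abs _ _
      _ = _ := by
          congr 1
          refine Finset.sum_congr rfl fun l _ => ?_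
          rw [abs_mul, abs_of_nonneg (mul_nonneg (hA0 i l) (hp l))]
  ext i
  exact abs_eq_zero.1 (congrFun this i)

theorem abs_exp_sub_exp_le {a b K : ℝ} (ha : Real.exp a ≤ K) (hb : Real.exp b ≤ K) :
    |Real.exp a - Real.exp b| ≤ K * |a - b| := by
  have key : ∀ {a b : ℝ}, Real.exp a ≤ K → b ≤ a → |Real.exp a - Real.exp b| ≤ K * |a - b| := by
    intro a b ha hab
    rw [abs_of_nonneg (sub_nonneg.2 (Real.exp_le_exp.2 hab)), abs_of_nonneg (sub_nonneg.2 hab)]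
    have h1 := Real.add_one_le_exp (b - a)
    have h2 : Real.exp b = Real.exp a * Real.exp (b - a) := by rw [← Real.exp_add]; ring_nf
    have h3 := Real.exp_pos a
    calc Real.exp a - Real.exp b = Real.exp a * (1 - Real.exp (b - a)) := by rw [h2]; ring
      _ ≤ Real.exp a * (a - b) := mul_le_mul_of_nonneg_left (by linarith) h3.le
      _ ≤ K * (a - b) := mul_le_mul_of_nonneg_right ha (by linarith)
  rcases le_total b a with h | h
  · exact key ha h
  · rw [abs_sub_comm, abs_sub_comm a b]
    exact key hb h

/-- On `{h ≤ K}` the exponential is `K`-Lipschitz, so `|g - h| ≤ t K A P |g - h|`. A bound `K > 1`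
is allowed because the implicit function is not known to stay below `1`. -/
theorem fixedPoint_unique [NeZero m] (hA : A.IsSymm) (hA0 : ∀ i j, 0 ≤ A i j)
    (hp : ∀ i, 0 ≤ p i) {t K : ℝ} (ht : 0 ≤ t) (hK : 0 ≤ K)
    (htr : t * K * (specRadius (A * Matrix.diagonal p)).toReal < 1) {x g h : Fin m → ℝ}
    (hg : g = progenyMap A p t x g) (hh : h = progenyMap A p t x h)
    (hgK : ∀ i, g i ≤ K) (hhK : ∀ i, h i ≤ K) : g = h := by
  have : (fun i => |g i - h i|) = 0 := by
    refine eq_zero_of_le_mulVec hA hp (mul_nonneg ht hK) htr (fun i => abs_nonneg _) fun i => ?_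
    have hgi := congrFun hg i
    have hhi := congrFun hh i
    have h1 := hgK i
    have h2 := hhK i
    rw [hgi] at h1
    rw [hhi] at h2
    rw [hgi, hhi]
    refine (abs_exp_sub_exp_le h1 h2).trans ?_
    rw [mul_comm t K, mul_assoc]
    gcongr
    rw [add_sub_add_left_eq_sub, ← mul_sub, abs_mul, abs_of_nonneg ht, ← Finset.sum_sub_distrib]
    gcongr
    refine (Finset.abs_sum_le_sum_abs _ _).trans (le_of_eq ?_)
    refine Finset.sum_congr rfl fun l _ => ?_
    rw [← mul_sub, abs_mul, abs_of_nonneg (mul_nonneg (hA0 i l) (hp l))]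
    congr 2
    ring
  ext i
  exact sub_eq_zero.1 (abs_eq_zero.1 (congrFun this i))

theorem isInvertible_of_injective {E : Type*} [NormedAddCommGroup E] [NormedSpace ℝ E]
    [FiniteDimensional ℝ E] {L : E →L[ℝ] E} (hL : Function.Injective L) : L.IsInvertible :=
  ⟨(LinearEquiv.ofInjectiveEndo (L : E →ₗ[ℝ] E) hL).toContinuousLinearEquiv, by ext; rfl⟩

/-- Below the critical time a fixed point extends smoothly to nearby parameters. -/
theorem exists_contDiffAt_fixedPoint [NeZero m] (hA : A.IsSymm) (hA0 : ∀ i j, 0 ≤ A i j)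
    (hp : ∀ i, 0 ≤ p i) {t : ℝ} (ht : 0 ≤ t)
    (htr : t * (specRadius (A * Matrix.diagonal p)).toReal < 1) {x h : Fin m → ℝ}
    (hh : h = progenyMap A p t x h) (hh1 : ∀ i, h i ≤ 1) :
    ∃ g : ℝ × (Fin m → ℝ) → Fin m → ℝ, ContDiffAt ℝ ((⊤ : ℕ∞) : WithTop ℕ∞) g (t, x) ∧
      g (t, x) = h ∧ ∀ᶠ q in 𝓝 (t, x), g q = progenyMap A p q.1 q.2 (g q) := by
  set F : (ℝ × (Fin m → ℝ)) × (Fin m → ℝ) → Fin m → ℝ :=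
    fun v => v.2 - progenyMap A p v.1.1 v.1.2 v.2
  have hF : ContDiffAt ℝ ((⊤ : ℕ∞) : WithTop ℕ∞) F ((t, x), h) :=
    (contDiff_snd.sub contDiff_progenyMap).contDiffAt
  have hn : ((⊤ : ℕ∞) : WithTop ℕ∞) ≠ 0 := by simp
  have hinv : (fderiv ℝ F ((t, x), h) ∘L .inr ℝ (ℝ × (Fin m → ℝ)) (Fin m → ℝ)).IsInvertible := by
    apply isInvertible_of_injective
    rw [injective_iff_map_eq_zero]
    intro v hv
    have hd : HasFDerivAt (fun y : Fin m → ℝ => F ((t, x), y))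
        (fderiv ℝ F ((t, x), h) ∘L .inr ℝ (ℝ × (Fin m → ℝ)) (Fin m → ℝ)) h :=
      HasFDerivAt.comp h (hF.differentiableAt hn).hasFDerivAt (hasFDerivAt_prodMk_right _ _)
    obtain ⟨L, hL, hLe⟩ := hasFDerivAt_progenyMap_comp (A := A) (p := p)
      (hasFDerivAt_const t h) (hasFDerivAt_const x h) (hasFDerivAt_id h)
    have hu := hd.unique ((hasFDerivAt_id h).sub hL)
    rw [hu] at hv
    -- At a fixed point the exponential prefactor is `h` itself, so a kernel vector satisfies `v = h
    -- · (t A P v)`.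
    refine eq_zero_of_eq_mul_mulVec hA hA0 hp ht htr (c := h) (fun i => ?_) hh1 fun i => ?_
    · rw [hh]; exact (Real.exp_pos _).le
    · have h1 := congrFun hv i
      have h2 := hLe v i
      simp only [id, ← hh] at h2
      simp at h1 h2
      linarith
  refine ⟨hF.implicitFunction hn hinv, hF.contDiffAt_implicitFunction hn hinv,
    hF.implicitFunction_apply_self hn hinv, ?_⟩
  filter_upwards [hF.eventually_apply_implicitFunction hn hinv] with q hq
  have h0 : F ((t, x), h) = 0 := by simp [F, ← hh]
  rw [h0] at hq
  exact sub_eq_zero.1 hq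

variable {H : ℝ → (Fin m → ℝ) → Fin m → ℝ}

/-- Below the critical time the fixed points in `[0,1]^m` form locally a smooth function. -/
theorem exists_eventuallyEq_fixedPoint [NeZero m] (hA : A.IsSymm) (hA0 : ∀ i j, 0 ≤ A i j)
    (hp : ∀ i, 0 ≤ p i)
    (hH : ∀ t, 0 ≤ t → ∀ x ∈ orthant m, H t x = progenyMap A p t x (H t x))
    (hH1 : ∀ t, 0 ≤ t → ∀ x ∈ orthant m, ∀ i, H t x i ≤ 1) {t : ℝ} (ht : 0 ≤ t)
    (htr : t * (specRadius (A * Matrix.diagonal p)).toReal < 1) {x : Fin m → ℝ}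
    (hx : x ∈ orthant m) :
    ∃ g : ℝ × (Fin m → ℝ) → Fin m → ℝ, ContDiffAt ℝ ((⊤ : ℕ∞) : WithTop ℕ∞) g (t, x) ∧
      (∀ᶠ q in 𝓝 (t, x), g q = progenyMap A p q.1 q.2 (g q)) ∧
      ∀ᶠ q in 𝓝 (t, x), 0 ≤ q.1 → q.2 ∈ orthant m → H q.1 q.2 = g q := by
  obtain ⟨g, hg, hgh, hgq⟩ := exists_contDiffAt_fixedPoint hA hA0 hp ht htr (hH t ht x hx)
    (hH1 t ht x hx)
  refine ⟨g, hg, hgq, ?_⟩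
  set r := (specRadius (A * Matrix.diagonal p)).toReal
  have hr : 0 ≤ r := ENNReal.toReal_nonneg
  have htr0 : 0 ≤ t * r := mul_nonneg ht hr
  -- Chosen so that `K > 1` and `t K r < 1`; both the bound `g < K` and the uniqueness condition
  -- then persist near `(t, x)`, with no continuity of `H` needed.
  set K := 2 / (1 + t * r)
  have hK : 1 < K := by rw [one_lt_div (by linarith)]; linarith
  have hKr : t * K * r < 1 := by
    have : t * K * r = 2 * (t * r) / (1 + t * r) := by simp only [K]; ring
    rw [this, div_lt_one (by linarith)]
    linarith
  have e1 : ∀ᶠ q in 𝓝 (t, x), q.1 * K * r < 1 :=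
    (Continuous.tendsto (by fun_prop : Continuous fun q : ℝ × (Fin m → ℝ) => q.1 * K * r)
      (t, x)).eventually_lt_const hKr
  have e2 : ∀ᶠ q in 𝓝 (t, x), ∀ i, g q i < K := by
    rw [eventually_all]
    intro i
    have hc : ContinuousAt (fun q => g q i) (t, x) := (continuousAt_pi.1 hg.continuousAt) i
    apply hc.eventually_lt_const
    beta_reduce
    rw [hgh]
    exact (hH1 t ht x hx i).trans_lt hK
  filter_upwards [e1, e2, hgq] with q h1 h2 h3 h4 h5
  exact fixedPoint_unique hA hA0 hp h4 (by linarith) h1 (hH _ h4 _ h5) h3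
    (fun i => (hH1 _ h4 _ h5 i).trans hK.le) fun i => (h2 i).le

theorem contDiffOn_fixedPoint [NeZero m] (hA : A.IsSymm) (hA0 : ∀ i j, 0 ≤ A i j)
    (hp : ∀ i, 0 ≤ p i)
    (hH : ∀ t, 0 ≤ t → ∀ x ∈ orthant m, H t x = progenyMap A p t x (H t x))
    (hH1 : ∀ t, 0 ≤ t → ∀ x ∈ orthant m, ∀ i, H t x i ≤ 1) :
    ContDiffOn ℝ ((⊤ : ℕ∞) : WithTop ℕ∞) (fun q : ℝ × (Fin m → ℝ) => fun i => p i * H q.1 q.2 i)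
      {q | 0 ≤ q.1 ∧ q.1 * (specRadius (A * Matrix.diagonal p)).toReal < 1 ∧
        q.2 ∈ orthant m} := by
  rintro ⟨t, x⟩ ⟨ht, htr, hx⟩
  obtain ⟨g, hg, -, hHg⟩ := exists_eventuallyEq_fixedPoint hA hA0 hp hH hH1 ht htr hx
  have hpg : ContDiffAt ℝ ((⊤ : ℕ∞) : WithTop ℕ∞) (fun q => fun i => p i * g q i) (t, x) :=
    contDiffAt_pi.2 fun i => contDiffAt_const.mul (contDiffAt_pi.1 hg i)
  refine hpg.contDiffWithinAt.congr_of_eventuallyEq ?_ ?_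
  · filter_upwards [mem_nhdsWithin_of_mem_nhds hHg, self_mem_nhdsWithin] with q h1 h2
    simp [h1 h2.1 h2.2.2]
  · simp [hHg.self_of_nhds ht hx]

theorem solvesBurgersAt_fixedPoint [NeZero m] (hA : A.IsSymm) (hA0 : ∀ i j, 0 ≤ A i j)
    (hp : ∀ i, 0 ≤ p i)
    (hH : ∀ t, 0 ≤ t → ∀ x ∈ orthant m, H t x = progenyMap A p t x (H t x))
    (hH1 : ∀ t, 0 ≤ t → ∀ x ∈ orthant m, ∀ i, H t x i ≤ 1) {t : ℝ} (ht : 0 ≤ t)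
    (htr : t * (specRadius (A * Matrix.diagonal p)).toReal < 1) {x : Fin m → ℝ}
    (hx : x ∈ orthant m) :
    SolvesBurgersAt A p (fun t x i => p i * H t x i) t x := by
  obtain ⟨g, hg, hgq, hHg⟩ := exists_eventuallyEq_fixedPoint hA hA0 hp hH hH1 ht htr hx
  obtain ⟨g', hg'⟩ := hg.differentiableAt (by simp)
  have hHtx : H t x = g (t, x) := hHg.self_of_nhds ht hx
  have hder : ∀ e i, g' e i = g (t, x) i * (-e.2 i + e.1 * ∑ l, A i l * p l * (g (t, x) l - 1)
      + t * ∑ l, A i l * p l * g' e l) := by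
    obtain ⟨L, hL, hLe⟩ := hasFDerivAt_progenyMap_comp (A := A) (p := p)
      (hasFDerivAt_fst (𝕜 := ℝ) (p := (t, x))) hasFDerivAt_snd hg'
    have : g' = L := hg'.unique (hL.congr_of_eventuallyEq hgq)
    intro e i
    have h1 := hLe e i
    rw [← this] at h1
    rw [h1, ← hgq.self_of_nhds]
    simp
  set w : Fin m → ℝ := A *ᵥ ((fun i => p i * H t x i) - p)
  have hw : ∀ i, w i = ∑ l, A i l * p l * (g (t, x) l - 1) := by
    intro i
    simp only [w, Matrix.mulVec, dotProduct, hHtx, Pi.sub_apply]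
    exact Finset.sum_congr rfl fun l _ => by ring
  -- In the characteristic direction `(1, w)` the terms `-w i` and `∑ A_il p_l (g l - 1)` cancel,
  -- leaving the homogeneous equation.
  have htransport : g' (1, w) = 0 := by
    refine eq_zero_of_eq_mul_mulVec hA hA0 hp ht htr (c := g (t, x)) (fun i => ?_) (fun i => ?_)
      fun i => ?_
    · rw [hgq.self_of_nhds]; exact (Real.exp_pos _).le
    · rw [← hHtx]; exact hH1 t ht x hx i
    · rw [hder]
      simp only [hw]
      ring
  have hsplit : ∀ i, g' (1, 0) i = -g' (0, w) i := by
    intro i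
    have : g' (1, w) = g' (1, 0) + g' (0, w) := by rw [← map_add]; simp
    rw [this] at htransport
    have := congrFun htransport i
    simp only [Pi.add_apply, Pi.zero_apply] at this
    linarith
  set D : (Fin m → ℝ) →L[ℝ] Fin m → ℝ :=
    ContinuousLinearMap.pi fun i => p i • ((ContinuousLinearMap.proj i).comp
      (g'.comp (ContinuousLinearMap.inr ℝ ℝ (Fin m → ℝ))))
  have hD : ∀ y i, D y i = p i * g' (0, y) i := fun y i => by simp [D]
  refine ⟨LinearMap.toMatrix' (D : (Fin m → ℝ) →ₗ[ℝ] Fin m → ℝ), ?_, ?_⟩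
  · have hJ : LinearMap.toContinuousLinearMap
        (LinearMap.toMatrix' (D : (Fin m → ℝ) →ₗ[ℝ] Fin m → ℝ)).mulVecLin = D := by
      ext1 y
      simp
    rw [hJ]
    have h1 : HasFDerivAt (fun y => g (t, y)) (g'.comp (ContinuousLinearMap.inr ℝ ℝ (Fin m → ℝ)))
        x := HasFDerivAt.comp x hg' (hasFDerivAt_prodMk_right t x)
    have h2 : HasFDerivAt (fun y => fun i => p i * g (t, y) i) D x :=
      hasFDerivAt_pi.2 fun i => (hasFDerivAt_pi'.1 h1 i).const_mul (p i)
    refine h2.hasFDerivWithinAt.congr_of_eventuallyEq ?_ ?_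
    · have hcont : Tendsto (fun y : Fin m → ℝ => (t, y)) (𝓝 x) (𝓝 (t, x)) :=
        Continuous.tendsto (by fun_prop) x
      filter_upwards [mem_nhdsWithin_of_mem_nhds (hcont.eventually hHg), self_mem_nhdsWithin]
        with y hy hy'
      simp [hy ht hy']
    · simp [hHtx]
  · have hJ : -(LinearMap.toMatrix' (D : (Fin m → ℝ) →ₗ[ℝ] Fin m → ℝ) *ᵥ
        (A *ᵥ ((fun i => p i * H t x i) - p))) = fun i => p i * g' (1, 0) i := by
      ext i
      rw [LinearMap.toMatrix'_mulVec, Pi.neg_apply, hsplit]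
      change -(D w i) = _
      rw [hD]
      ring
    rw [hJ]
    have h1 : HasDerivAt (fun s => g (s, x)) (g' (1, 0)) t :=
      HasFDerivAt.comp_hasDerivAt t (f := fun s => (s, x)) hg'
        ((hasDerivAt_id t).prodMk (hasDerivAt_const t x))
    have h2 : HasDerivAt (fun s => fun i => p i * g (s, x) i) (fun i => p i * g' (1, 0) i) t :=
      hasDerivAt_pi.2 fun i => (hasDerivAt_pi.1 h1 i).const_mul (p i)
    refine h2.hasDerivWithinAt.congr_of_eventuallyEq ?_ ?_
    · have hcont : Tendsto (fun s : ℝ => (s, x)) (𝓝 t) (𝓝 (t, x)) :=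
        Continuous.tendsto (by fun_prop) t
      filter_upwards [mem_nhdsWithin_of_mem_nhds (hcont.eventually hHg), self_mem_nhdsWithin]
        with y hy hy'
      simp [hy hy' hx]
    · simp [hHtx]

/-- At the critical time the fixed points are not differentiable at the origin. -/
theorem not_differentiableWithinAt_fixedPoint [NeZero m] (hA : A.IsSymm)
    (hA0 : ∀ i j, 0 ≤ A i j) (hp : ∀ i, 0 ≤ p i) {t : ℝ}
    (htr : t * (specRadius (A * Matrix.diagonal p)).toReal = 1) {h : (Fin m → ℝ) → Fin m → ℝ}
    (hh : ∀ x ∈ orthant m, h x = progenyMap A p t x (h x)) :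
    ¬ DifferentiableWithinAt ℝ (fun x => fun i => p i * h x i) (orthant m) 0 := by
  intro hdiff
  set r := (specRadius (A * Matrix.diagonal p)).toReal
  have hr : 0 < r := by
    rcases (ENNReal.toReal_nonneg : 0 ≤ r).eq_or_lt with h0 | h0
    · exact absurd htr (by simp [r, ← h0])
    · exact h0
  obtain ⟨φ, hφ0, hφ, hφA⟩ := exists_nonneg_left_eigenvector hA hA0 hp hr
  -- This is `t φ A P = φ`, by the eigenvector equation and `t r = 1`.
  have hpair : ∀ v : Fin m → ℝ, ∑ i, φ i * (t * ∑ l, A i l * p l * v l) = ∑ l, φ l * v l := by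
    intro v
    simp only [Finset.mul_sum]
    rw [Finset.sum_comm]
    refine Finset.sum_congr rfl fun l _ => ?_
    have : ∑ i, φ i * (t * (A i l * p l * v l)) = t * (∑ i, φ i * (A i l * p l)) * v l := by
      rw [Finset.mul_sum, Finset.sum_mul]
      exact Finset.sum_congr rfl fun i _ => by ring
    rw [this, hφA]
    linear_combination φ l * v l * htr
  have h0mem : (0 : Fin m → ℝ) ∈ orthant m := fun i => le_rfl
  -- the value at the origin is one on the support of the eigenvector
  have hone : ∀ i, φ i * (h 0 i - 1) = 0 := by
    have hle : ∀ i, t * ∑ l, A i l * p l * (h 0 l - 1) ≤ h 0 i - 1 := by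
      intro i
      have h1 := congrFun (hh 0 h0mem) i
      have h2 := Real.add_one_le_exp (-(0 : Fin m → ℝ) i + t * ∑ l, A i l * p l * (h 0 l - 1))
      rw [progenyMap] at h1
      rw [← h1] at h2
      simp only [Pi.zero_apply] at h2
      linarith
    have hsum := hpair fun l => h 0 l - 1
    -- The termwise inequality `hle`, from `1 + y ≤ e^y`, has equal `φ`-weighted sums on both sides,
    -- so it is an equality wherever `φ i > 0`; strictness for `y ≠ 0` then gives `h 0 i = 1`.
    have heq : ∀ i, φ i * (t * ∑ l, A i l * p l * (h 0 l - 1)) = φ i * (h 0 i - 1) := by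
      have := (Finset.sum_eq_sum_iff_of_le
        (fun i _ => mul_le_mul_of_nonneg_left (hle i) (hφ0 i))).1 hsum
      exact fun i => this i (Finset.mem_univ i)
    intro i
    rcases (hφ0 i).eq_or_lt with h0 | h0
    · rw [← h0]; simp
    have h1 := congrFun (hh 0 h0mem) i
    have h2 : t * ∑ l, A i l * p l * (h 0 l - 1) = h 0 i - 1 := mul_left_cancel₀ h0.ne' (heq i)
    rw [progenyMap, h2] at h1
    simp only [Pi.zero_apply, neg_zero, zero_add] at h1
    by_contra hne
    have hne' : h 0 i - 1 ≠ 0 := fun hc => hne (by rw [hc, mul_zero])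
    have := Real.add_one_lt_exp hne'
    linarith
  obtain ⟨u', hu'⟩ := hdiff
  -- derivative along the diagonal
  have hline : HasDerivWithinAt (fun s : ℝ => fun i => p i * h (fun _ => s) i)
      (u' fun _ => 1) (Set.Ici 0) 0 := by
    have hl : HasDerivWithinAt (fun s : ℝ => fun _ : Fin m => s) (fun _ => 1) (Set.Ici 0) 0 :=
      hasDerivWithinAt_pi.2 fun _ => hasDerivWithinAt_id _ _
    exact HasFDerivWithinAt.comp_hasDerivWithinAt (0 : ℝ) (f := fun s : ℝ => fun _ : Fin m => s)
      hu' hl fun s hs i => hs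
  set w : Fin m → ℝ := fun i => ∑ l, A i l * u' (fun _ => 1) l
  -- Differentiability is assumed only for `p l * h l`, which is all that enters the exponent.
  have hE : ∀ i, HasDerivWithinAt
      (fun s : ℝ => -s + t * ∑ l, A i l * p l * (h (fun _ => s) l - 1)) (-1 + t * w i)
      (Set.Ici 0) 0 := by
    intro i
    have h1 : HasDerivWithinAt (fun s : ℝ => ∑ l, A i l * (p l * h (fun _ => s) l - p l)) (w i)
        (Set.Ici 0) 0 :=
      HasDerivWithinAt.fun_sum fun l _ =>
        ((hasDerivWithinAt_pi.1 hline l).sub_const (p l)).const_mul (A i l)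
    have h2 := (hasDerivWithinAt_id (0 : ℝ) (Set.Ici 0)).neg.add (h1.const_mul t)
    refine h2.congr_of_mem (fun s _ => ?_) Set.self_mem_Ici
    simp only [Pi.add_apply, Pi.neg_apply, id]
    congr 2
    exact Finset.sum_congr rfl fun l _ => by ring
  -- First computation: through the exponential, whose value at `0` is `1` where `φ i > 0`.
  have hd1 : HasDerivWithinAt (fun s : ℝ => ∑ i, φ i * (h (fun _ => s) i - 1))
      (∑ i, φ i * (-1 + t * w i)) (Set.Ici 0) 0 := by
    refine HasDerivWithinAt.fun_sum fun i _ => ?_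
    rcases (hφ0 i).eq_or_lt with h0 | h0
    · rw [← h0]; simpa using hasDerivWithinAt_const (0 : ℝ) (Set.Ici 0) (0 : ℝ)
    refine HasDerivWithinAt.const_mul _ (HasDerivWithinAt.sub_const _ ?_)
    have h1 : h 0 i = 1 := by
      have := hone i
      rcases mul_eq_zero.1 this with hc | hc
      · exact absurd hc h0.ne'
      · linarith
    have h2 := (hE i).exp
    have h3 : Real.exp (-0 + t * ∑ l, A i l * p l * (h (fun _ => 0) l - 1)) = 1 := by
      have := congrFun (hh 0 h0mem) i
      rw [h1] at this
      exact this.symm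
    rw [h3, one_mul] at h2
    refine h2.congr_of_mem (fun s hs => ?_) Set.self_mem_Ici
    exact congrFun (hh (fun _ => s) fun _ => hs) i
  -- Second computation: through the linear identity `hpair`, which removes the `-s` from the
  -- exponent and hence the `-1` from the derivative.
  have hd2 : HasDerivWithinAt (fun s : ℝ => ∑ i, φ i * (h (fun _ => s) i - 1))
      (∑ i, φ i * (t * w i)) (Set.Ici 0) 0 := by
    have h1 : HasDerivWithinAt (fun s : ℝ => ∑ i, φ i *
        ((-s + t * ∑ l, A i l * p l * (h (fun _ => s) l - 1)) + s))
        (∑ i, φ i * ((-1 + t * w i) + 1)) (Set.Ici 0) 0 :=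
      HasDerivWithinAt.fun_sum fun i _ =>
        HasDerivWithinAt.const_mul _ ((hE i).add (hasDerivWithinAt_id _ _))
    convert h1 using 1
    · ext s
      rw [← hpair]
      exact Finset.sum_congr rfl fun i _ => by ring
    · exact Finset.sum_congr rfl fun i _ => by ring
  have hu := (uniqueDiffWithinAt_Ici (0 : ℝ)).eq_deriv _ hd1 hd2
  have hsum : ∑ i, φ i = 0 := by
    have : ∑ i, φ i * (-1 + t * w i) = ∑ i, φ i * (t * w i) - ∑ i, φ i := by
      rw [← Finset.sum_sub_distrib]
      exact Finset.sum_congr rfl fun i _ => by ring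
    linarith
  apply hφ
  ext i
  exact (Finset.sum_eq_zero_iff_of_nonneg fun i _ => hφ0 i).1 hsum i (Finset.mem_univ i)

end FixedPoint

end Coagulation

namespace Coagulation

/-! ### Generating functions of random vectors -/

section GeneratingFunction

open Filter Topology

variable {m : ℕ}

/-- The monomial `s^n` with values in `[0,∞]`. -/
noncomputable def monomial (s : Fin m → ℝ≥0∞) (n : Fin m → ℕ) : ℝ≥0∞ := ∏ l, s l ^ n l

theorem monomial_add (s : Fin m → ℝ≥0∞) (a b : Fin m → ℕ) :
    monomial s (a + b) = monomial s a * monomial s b := by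
  simp [monomial, pow_add, Finset.prod_mul_distrib]

theorem monomial_zero (s : Fin m → ℝ≥0∞) : monomial s 0 = 1 := by simp [monomial]

theorem monomial_sum {ι : Type*} (s : Fin m → ℝ≥0∞) (f : ι → Fin m → ℕ) (t : Finset ι) :
    monomial s (∑ i ∈ t, f i) = ∏ i ∈ t, monomial s (f i) := by
  classical
  induction t using Finset.induction_on with
  | empty => simp [monomial_zero]
  | insert a t ha ih => rw [Finset.sum_insert ha, Finset.prod_insert ha, monomial_add, ih]

theorem monomial_mul (s v : Fin m → ℝ≥0∞) (n : Fin m → ℕ) :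
    monomial (fun l => s l * v l) n = monomial s n * monomial v n := by
  simp [monomial, mul_pow, Finset.prod_mul_distrib]

theorem monomial_single (s : Fin m → ℝ≥0∞) (i : Fin m) : monomial s (Pi.single i 1) = s i := by
  rw [monomial, Finset.prod_eq_single i] <;> simp +contextual

theorem monomial_le_one {s : Fin m → ℝ≥0∞} (hs : ∀ l, s l ≤ 1) (n : Fin m → ℕ) :
    monomial s n ≤ 1 :=
  Finset.prod_le_one' fun l _ => pow_le_one' (hs l) _

variable {Ω : Type*} [MeasurableSpace Ω] {μ : Measure Ω} {T : Ω → Fin m → ℕ∞}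

theorem tsum_measure_le_one [IsProbabilityMeasure μ]
    (hT : ∀ n : Fin m → ℕ, MeasurableSet {ω | ∀ i, T ω i = (n i : ℕ∞)}) :
    ∑' n : Fin m → ℕ, μ {ω | ∀ i, T ω i = (n i : ℕ∞)} ≤ 1 := by
  refine (tsum_meas_le_meas_iUnion_of_disjoint μ hT ?_).trans prob_le_one
  intro a b hab
  refine Set.disjoint_left.2 fun ω ha hb => hab ?_
  ext i
  have := (ha i).symm.trans (hb i)
  exact_mod_cast this

theorem summable_measureReal [IsProbabilityMeasure μ]
    (hT : ∀ n : Fin m → ℕ, MeasurableSet {ω | ∀ i, T ω i = (n i : ℕ∞)}) :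
    Summable fun n : Fin m → ℕ => μ.real {ω | ∀ i, T ω i = (n i : ℕ∞)} :=
  ENNReal.summable_toReal (ne_top_of_le_ne_top ENNReal.one_ne_top (tsum_measure_le_one hT))

theorem norm_pgf_term_le {s : Fin m → ℝ} (hs : ∀ l, 0 ≤ s l ∧ s l ≤ 1) (n : Fin m → ℕ) :
    ‖μ.real {ω | ∀ i, T ω i = (n i : ℕ∞)} * ∏ i, s i ^ n i‖
      ≤ μ.real {ω | ∀ i, T ω i = (n i : ℕ∞)} := by
  rw [norm_mul, Real.norm_of_nonneg measureReal_nonneg,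
    Real.norm_of_nonneg (Finset.prod_nonneg fun i _ => pow_nonneg (hs i).1 _)]
  exact mul_le_of_le_one_right measureReal_nonneg
    (Finset.prod_le_one (fun i _ => pow_nonneg (hs i).1 _) fun i _ => pow_le_one₀ (hs i).1 (hs i).2)

/-- The probabilities are a summable majorant on the whole closed cube, so continuity includes `s l
= 1`, that is, the boundary `x l = 0`. -/
theorem continuousOn_pgf [IsProbabilityMeasure μ]
    (hT : ∀ n : Fin m → ℕ, MeasurableSet {ω | ∀ i, T ω i = (n i : ℕ∞)}) :
    ContinuousOn (pgf μ T) {s | ∀ l, 0 ≤ s l ∧ s l ≤ 1} :=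
  continuousOn_tsum (fun _ => (by fun_prop : Continuous _).continuousOn) (summable_measureReal hT)
    fun _ _ hs => norm_pgf_term_le hs _

theorem pgf_nonneg {s : Fin m → ℝ} (hs : ∀ l, 0 ≤ s l) : 0 ≤ pgf μ T s :=
  tsum_nonneg fun _ =>
    mul_nonneg measureReal_nonneg (Finset.prod_nonneg fun i _ => pow_nonneg (hs i) _)

theorem ofReal_pgf_eq_tsum [IsProbabilityMeasure μ]
    (hT : ∀ n : Fin m → ℕ, MeasurableSet {ω | ∀ i, T ω i = (n i : ℕ∞)}) {s : Fin m → ℝ}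
    (hs : ∀ l, 0 ≤ s l ∧ s l ≤ 1) :
    ENNReal.ofReal (pgf μ T s) = ∑' n : Fin m → ℕ, μ {ω | ∀ i, T ω i = (n i : ℕ∞)} *
      monomial (fun l => ENNReal.ofReal (s l)) n := by
  rw [pgf, ENNReal.ofReal_tsum_of_nonneg]
  · refine tsum_congr fun n => ?_
    rw [ENNReal.ofReal_mul measureReal_nonneg, ofReal_measureReal,
      ENNReal.ofReal_prod_of_nonneg fun i _ => pow_nonneg (hs i).1 _, monomial]
    congr 1
    exact Finset.prod_congr rfl fun l _ => ENNReal.ofReal_pow (hs l).1 _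
  · exact fun n =>
      mul_nonneg measureReal_nonneg (Finset.prod_nonneg fun i _ => pow_nonneg (hs i).1 _)
  · exact (summable_measureReal hT).of_norm_bounded fun _ => norm_pgf_term_le hs _

theorem pgf_le_one [IsProbabilityMeasure μ]
    (hT : ∀ n : Fin m → ℕ, MeasurableSet {ω | ∀ i, T ω i = (n i : ℕ∞)}) {s : Fin m → ℝ}
    (hs : ∀ l, 0 ≤ s l ∧ s l ≤ 1) : pgf μ T s ≤ 1 := by
  rw [← ENNReal.ofReal_le_one, ofReal_pgf_eq_tsum hT hs]
  refine le_trans (ENNReal.tsum_le_tsum fun n => ?_) (tsum_measure_le_one (μ := μ) hT)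
  exact mul_le_of_le_one_right' (monomial_le_one (fun l => ENNReal.ofReal_le_one.2 (hs l).2) n)

/-- The integrand of the generating function: it vanishes if `T` has an infinite component. -/
theorem lintegral_tsum_indicator
    (hT : ∀ n : Fin m → ℕ, MeasurableSet {ω | ∀ i, T ω i = (n i : ℕ∞)}) (s : Fin m → ℝ≥0∞) :
    ∫⁻ ω, ∑' n : Fin m → ℕ, {ω | ∀ i, T ω i = (n i : ℕ∞)}.indicator 1 ω * monomial s n ∂μ =
      ∑' n : Fin m → ℕ, μ {ω | ∀ i, T ω i = (n i : ℕ∞)} * monomial s n := by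
  have hm : ∀ n : Fin m → ℕ, Measurable fun ω =>
      {ω | ∀ i, T ω i = (n i : ℕ∞)}.indicator (1 : Ω → ℝ≥0∞) ω * monomial s n := fun n =>
    (measurable_one.indicator (hT n)).mul measurable_const
  rw [lintegral_tsum fun n => (hm n).aemeasurable]
  refine tsum_congr fun n => ?_
  rw [lintegral_mul_const _ (measurable_one.indicator (hT n)), lintegral_indicator_one (hT n)]

omit [MeasurableSpace Ω] in
theorem tsum_indicator_eq_monomial {ω : Ω} {n : Fin m → ℕ} (h : ∀ i, T ω i = (n i : ℕ∞))
    (s : Fin m → ℝ≥0∞) :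
    ∑' k : Fin m → ℕ, {ω | ∀ i, T ω i = (k i : ℕ∞)}.indicator 1 ω * monomial s k
      = monomial s n := by
  rw [tsum_eq_single n]
  · rw [Set.indicator_of_mem (show ω ∈ {ω | ∀ i, T ω i = (n i : ℕ∞)} from h), Pi.one_apply,
      one_mul]
  · intro k hk
    rw [Set.indicator_of_notMem, zero_mul]
    intro hmem
    apply hk
    ext i
    have := (hmem i).symm.trans (h i)
    exact_mod_cast this

theorem measurableSet_forall_coe_eq {Y : Ω → Fin m → ℕ} (hY : Measurable Y) (n : Fin m → ℕ) :
    MeasurableSet {ω | ∀ i, ((Y ω i : ℕ) : ℕ∞) = (n i : ℕ∞)} := by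
  have : {ω | ∀ i, ((Y ω i : ℕ) : ℕ∞) = (n i : ℕ∞)} = Y ⁻¹' {n} := by
    ext ω
    simp [funext_iff]
  rw [this]
  exact hY (measurableSet_singleton n)

theorem ofReal_pgf_coe_eq_lintegral [IsProbabilityMeasure μ] {Y : Ω → Fin m → ℕ}
    (hY : Measurable Y) {s : Fin m → ℝ} (hs : ∀ l, 0 ≤ s l ∧ s l ≤ 1) :
    ENNReal.ofReal (pgf μ (fun ω l => (Y ω l : ℕ∞)) s)
      = ∫⁻ ω, monomial (fun l => ENNReal.ofReal (s l)) (Y ω) ∂μ := by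
  rw [ofReal_pgf_eq_tsum (measurableSet_forall_coe_eq hY) hs,
    ← lintegral_tsum_indicator (measurableSet_forall_coe_eq hY)]
  exact lintegral_congr fun ω => tsum_indicator_eq_monomial (n := Y ω) (fun i => rfl) _

end GeneratingFunction

/-! ### The total progeny of a branching process -/

section Branching

open Filter Topology

variable {m : ℕ} {Ω : Type*} [MeasurableSpace Ω] {μ : Measure Ω}
  {X : Fin m → ℕ → ℕ → Ω → Fin m → ℕ}

/-- The `σ`-algebra generated by the offspring vectors of the generations in `S`. -/
@[reducible]
def offspringSigma (X : Fin m → ℕ → ℕ → Ω → Fin m → ℕ) (S : Set ℕ) : MeasurableSpace Ω :=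
  ⨆ q ∈ {q : Fin m × ℕ × ℕ | q.2.1 ∈ S},
    MeasurableSpace.comap (X q.1 q.2.1 q.2.2) inferInstance

omit [MeasurableSpace Ω] in
theorem offspringSigma_mono {S S' : Set ℕ} (h : S ⊆ S') :
    offspringSigma X S ≤ offspringSigma X S' :=
  biSup_mono fun _ hq => h hq

theorem offspringSigma_le (hX : ∀ k n j, Measurable (X k n j)) (S : Set ℕ) :
    offspringSigma X S ≤ ‹MeasurableSpace Ω› :=
  iSup₂_le fun q _ => (hX q.1 q.2.1 q.2.2).comap_le

omit [MeasurableSpace Ω] in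
theorem measurable_offspring {S : Set ℕ} (k : Fin m) {n : ℕ} (hn : n ∈ S) (j : ℕ) :
    Measurable[offspringSigma X S] (X k n j) := by
  rw [measurable_iff_comap_le]
  exact le_iSup₂_of_le (f := fun (q : Fin m × ℕ × ℕ) (_ : q ∈ {q : Fin m × ℕ × ℕ | q.2.1 ∈ S}) =>
    MeasurableSpace.comap (X q.1 q.2.1 q.2.2) inferInstance) (k, n, j) hn le_rfl

theorem indep_offspringSigma (hX : ∀ k n j, Measurable (X k n j))
    (hind : iIndepFun (fun q : Fin m × ℕ × ℕ => X q.1 q.2.1 q.2.2) μ) {S S' : Set ℕ}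
    (h : Disjoint S S') : Indep (offspringSigma X S) (offspringSigma X S') μ := by
  refine indep_iSup_of_disjoint
    (m := fun q : Fin m × ℕ × ℕ => MeasurableSpace.comap (X q.1 q.2.1 q.2.2) inferInstance)
    (fun q => (hX q.1 q.2.1 q.2.2).comap_le) hind.iIndep ?_
  exact Set.disjoint_left.2 fun q hq hq' => Set.disjoint_left.1 h hq hq'

/-- Handles the random number of summands in a generation by fixing its countably many values. -/
theorem measurable_comp_of_countable {α β γ : Type*} [MeasurableSpace α] [MeasurableSpace β]
    [MeasurableSpace γ] [Countable β] [MeasurableSingletonClass β] {Z : α → β} (hZ : Measurable Z)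
    {f : β → α → γ} (hf : ∀ z, Measurable (f z)) : Measurable fun a => f (Z a) a :=
  (measurable_from_prod_countable_right (f := fun q : β × α => f q.1 q.2) hf).comp
    (hZ.prodMk measurable_id)

theorem measurable_sum_nat {α ι : Type*} [MeasurableSpace α] {f : ι → α → Fin m → ℕ} (s : Finset ι)
    (hf : ∀ i ∈ s, Measurable (f i)) : Measurable fun a => ∑ i ∈ s, f i a := by
  refine measurable_pi_iff.2 fun l => ?_
  simp only [Finset.sum_apply]
  exact Finset.measurable_sum s fun i hi => (measurable_pi_apply l).comp (hf i hi)

omit [MeasurableSpace Ω] in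
-- Generation `n` depends only on offspring of generations strictly before `n`, hence is independent
-- of the offspring in generation `n`.
theorem measurable_generation (i : Fin m) (n : ℕ) :
    Measurable[offspringSigma X (Set.Iio n)] (generation X i n) := by
  induction n with
  | zero => exact @measurable_const _ _ _ (_) _
  | succ n ih =>
    refine @measurable_comp_of_countable _ _ _ (offspringSigma X (Set.Iio (n + 1))) _ _ _ _ _
      (ih.mono (offspringSigma_mono (Set.Iio_subset_Iio n.le_succ)) le_rfl)
      (fun z ω => ∑ k, ∑ j ∈ Finset.range (z k), X k n j ω) fun z => ?_
    refine @measurable_sum_nat _ _ _ (_) _ _ fun k _ => ?_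
    exact @measurable_sum_nat _ _ _ (_) _ _ fun j _ =>
      measurable_offspring k (Set.mem_Iio.2 n.lt_succ_self) j

/-- The number of individuals in the first `N` generations. -/
def partialProgeny (X : Fin m → ℕ → ℕ → Ω → Fin m → ℕ) (i : Fin m) (N : ℕ) (ω : Ω) : Fin m → ℕ :=
  ∑ n ∈ Finset.range N, generation X i n ω

omit [MeasurableSpace Ω] in
theorem measurable_partialProgeny_succ (i : Fin m) (N : ℕ) :
    Measurable[offspringSigma X (Set.Iio N)] (partialProgeny X i (N + 1)) :=
  @measurable_sum_nat _ _ _ (_) _ _ fun n hn => (measurable_generation i n).mono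
    (offspringSigma_mono (Set.Iio_subset_Iio (Finset.mem_range_succ_iff.1 hn))) le_rfl

theorem measurable_of_discrete_monomial (s : Fin m → ℝ≥0∞) : Measurable (monomial s) :=
  measurable_of_countable _

/-- The branching property: conditioning on the first `n` generations. -/
theorem lintegral_mul_monomial_generation (hX : ∀ k n j, Measurable (X k n j))
    (hind : iIndepFun (fun q : Fin m × ℕ × ℕ => X q.1 q.2.1 q.2.2) μ) (i : Fin m) (n : ℕ)
    {v g : Fin m → ℝ≥0∞} (hg : ∀ k j, ∫⁻ ω, monomial v (X k n j ω) ∂μ = g k) {W : Ω → ℝ≥0∞}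
    (hW : Measurable[offspringSigma X (Set.Iio n)] W) :
    ∫⁻ ω, W ω * monomial v (generation X i (n + 1) ω) ∂μ
      = ∫⁻ ω, W ω * monomial g (generation X i n ω) ∂μ := by
  have hle := offspringSigma_le hX (Set.Iio n)
  have hle' := offspringSigma_le hX {n}
  -- Conditioning is done by splitting over the countably many values `z` of generation `n`.
  have hdecomp : ∀ f : (Fin m → ℕ) → Ω → ℝ≥0∞, ∀ ω, f (generation X i n ω) ω
      = ∑' z : Fin m → ℕ, (generation X i n ⁻¹' {z}).indicator 1 ω * f z ω := by
    intro f ω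
    rw [tsum_eq_single (generation X i n ω)]
    · simp
    · intro z hz
      rw [Set.indicator_of_notMem (by simpa using hz.symm), zero_mul]
  have hZ : ∀ z, Measurable[offspringSigma X (Set.Iio n)]
      ((generation X i n ⁻¹' {z}).indicator (1 : Ω → ℝ≥0∞)) := fun z =>
    @Measurable.indicator _ _ (_) _ _ _ _ (@measurable_const _ _ _ (_) 1)
      (measurable_generation i n (measurableSet_singleton z))
  have hV : ∀ z : Fin m → ℕ, Measurable[offspringSigma X {n}] fun ω =>
      monomial v (∑ k, ∑ j ∈ Finset.range (z k), X k n j ω) := fun z =>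
    (measurable_of_discrete_monomial v).comp <| @measurable_sum_nat _ _ _ (_) _ _ fun k _ =>
      @measurable_sum_nat _ _ _ (_) _ _ fun j _ => measurable_offspring k (Set.mem_singleton n) j
  -- For fixed `z` the monomial is a product over independent offspring vectors, `z k` of them of
  -- type `k`.
  have hexp : ∀ z : Fin m → ℕ,
      ∫⁻ ω, monomial v (∑ k, ∑ j ∈ Finset.range (z k), X k n j ω) ∂μ = monomial g z := by
    intro z
    have hinj : Function.Injective fun q : (_ : Fin m) × ℕ => (q.1, n, q.2) := by
      rintro ⟨a, b⟩ ⟨c, d⟩ h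
      simp only [Prod.mk.injEq, true_and] at h
      rw [h.1, h.2]
    have hindm := (hind.precomp hinj).comp (fun _ => monomial v)
      fun _ => measurable_of_discrete_monomial v
    have hprod := lintegral_prod_eq_prod_lintegral_of_indepFun
      (Finset.univ.sigma fun k => Finset.range (z k)) _ hindm
      fun q => (measurable_of_discrete_monomial v).comp (hX q.1 n q.2)
    have hl : ∀ ω, monomial v (∑ k, ∑ j ∈ Finset.range (z k), X k n j ω)
        = ∏ q ∈ Finset.univ.sigma fun k => Finset.range (z k), monomial v (X q.1 n q.2 ω) := by
      intro ω
      rw [monomial_sum, Finset.prod_sigma]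
      exact Finset.prod_congr rfl fun k _ => monomial_sum _ _ _
    simp only [hl]
    refine hprod.trans ?_
    rw [Finset.prod_sigma]
    simp only [Function.comp_apply, hg, Finset.prod_const, Finset.card_range]
    rfl
  have hl := hdecomp fun z ω => W ω * monomial v (∑ k, ∑ j ∈ Finset.range (z k), X k n j ω)
  have hr := hdecomp fun z ω => W ω * monomial g z
  have hWm := hW.mono hle le_rfl
  calc ∫⁻ ω, W ω * monomial v (generation X i (n + 1) ω) ∂μ
      = ∫⁻ ω, ∑' z : Fin m → ℕ, (generation X i n ⁻¹' {z}).indicator 1 ω *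
          (W ω * monomial v (∑ k, ∑ j ∈ Finset.range (z k), X k n j ω)) ∂μ :=
        lintegral_congr hl
    _ = ∑' z : Fin m → ℕ, ∫⁻ ω, (generation X i n ⁻¹' {z}).indicator 1 ω *
          (W ω * monomial v (∑ k, ∑ j ∈ Finset.range (z k), X k n j ω)) ∂μ :=
        lintegral_tsum fun z => (((hZ z).mono hle le_rfl).mul
          (hWm.mul ((hV z).mono hle' le_rfl))).aemeasurable
    _ = ∑' z : Fin m → ℕ, ∫⁻ ω, (generation X i n ⁻¹' {z}).indicator 1 ω *
          (W ω * monomial g z) ∂μ := by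
        refine tsum_congr fun z => ?_
        have hm : Measurable[offspringSigma X (Set.Iio n)]
            fun ω => (generation X i n ⁻¹' {z}).indicator 1 ω * W ω :=
          @Measurable.mul _ _ _ _ _ (_) _ _ (hZ z) hW
        have := lintegral_mul_eq_lintegral_mul_lintegral_of_independent_measurableSpace hle hle'
          (indep_offspringSigma hX hind (by simp)) hm (hV z)
        simp only [← mul_assoc]
        rw [this, hexp, lintegral_mul_const _ (hm.mono hle le_rfl)]
    _ = ∫⁻ ω, ∑' z : Fin m → ℕ, (generation X i n ⁻¹' {z}).indicator 1 ω *
          (W ω * monomial g z) ∂μ :=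
        (lintegral_tsum fun z => (((hZ z).mono hle le_rfl).mul
          (hWm.mul measurable_const)).aemeasurable).symm
    _ = _ := (lintegral_congr hr).symm

/-- The iterates of `v ↦ s G(v)` are the generating functions of the first generations. -/
theorem lintegral_monomial_partialProgeny (hX : ∀ k n j, Measurable (X k n j))
    (hind : iIndepFun (fun q : Fin m × ℕ × ℕ => X q.1 q.2.1 q.2.2) μ) (i : Fin m)
    {s : Fin m → ℝ≥0∞} {g G : ℕ → Fin m → ℝ≥0∞} (hg0 : g 0 = s)
    (hG : ∀ N k n j, ∫⁻ ω, monomial (g N) (X k n j ω) ∂μ = G N k)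
    (hg : ∀ N, g (N + 1) = fun k => s k * G N k)
    (N n : ℕ) :
    ∫⁻ ω, monomial s (partialProgeny X i n ω) * monomial (g N) (generation X i n ω) ∂μ
      = ∫⁻ ω, monomial s (partialProgeny X i (n + N + 1) ω) ∂μ := by
  induction N generalizing n with
  | zero =>
    refine lintegral_congr fun ω => ?_
    rw [hg0, ← monomial_add, partialProgeny, partialProgeny, Finset.sum_range_succ]
  | succ N ih =>
    -- As `g (N + 1) = s · G N`, the factor `s^{Z_n}` joins the partial progeny, and `G N` to the
    -- power `Z_n` is the conditional mean of `g N` to the power `Z_{n+1}`.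
    have h1 : ∀ ω, monomial s (partialProgeny X i n ω) * monomial (g (N + 1)) (generation X i n ω)
        = monomial s (partialProgeny X i (n + 1) ω) * monomial (G N) (generation X i n ω) := by
      intro ω
      rw [hg, monomial_mul, ← mul_assoc, ← monomial_add, partialProgeny, partialProgeny,
        Finset.sum_range_succ]
    rw [lintegral_congr h1, ← lintegral_mul_monomial_generation hX hind i n (fun k j => hG N k n j)
      (W := fun ω => monomial s (partialProgeny X i (n + 1) ω))
      ((measurable_of_discrete_monomial s).comp (measurable_partialProgeny_succ i n)), ih,
      add_right_comm n 1 N, add_assoc n N 1]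

end Branching

end Coagulation

namespace Coagulation

/-! ### Passage from truncated to total progeny -/

section TotalProgeny

open Filter Topology

variable {m : ℕ} {Ω : Type*} [MeasurableSpace Ω] {μ : Measure Ω}
  {X : Fin m → ℕ → ℕ → Ω → Fin m → ℕ}

omit [MeasurableSpace Ω] in
theorem tendsto_partialProgeny (i : Fin m) (ω : Ω) (l : Fin m) :
    Tendsto (fun N => (partialProgeny X i N ω l : ℕ∞)) atTop (𝓝 (totalProgeny X i ω l)) := by
  have h : totalProgeny X i ω l = ⨆ N, (partialProgeny X i N ω l : ℕ∞) := by
    simp only [totalProgeny, partialProgeny, Finset.sum_apply, Nat.cast_sum]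
  rw [h]
  refine tendsto_atTop_iSup fun a b hab => ?_
  simp only [partialProgeny, Finset.sum_apply, Nat.cast_le]
  exact Finset.sum_le_sum_of_subset (Finset.range_mono hab)

omit [MeasurableSpace Ω] in
-- Finite points of `ℕ∞` are isolated, so convergence to one means being eventually constant.
theorem totalProgeny_eq_coe_iff (i : Fin m) (ω : Ω) (l : Fin m) (c : ℕ) :
    totalProgeny X i ω l = c ↔ ∀ᶠ N in atTop, partialProgeny X i N ω l = c := by
  have ht := tendsto_partialProgeny (X := X) i ω l
  constructor
  · intro h
    rw [h, ENat.nhds_natCast, tendsto_pure] at ht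
    exact ht.mono fun N hN => by exact_mod_cast hN
  · intro h
    refine tendsto_nhds_unique ht (tendsto_const_nhds.congr' ?_)
    exact h.mono fun N hN => congrArg _ hN.symm

theorem measurableSet_totalProgeny_eq (hX : ∀ k n j, Measurable (X k n j)) (i : Fin m)
    (n : Fin m → ℕ) : MeasurableSet {ω | ∀ l, totalProgeny X i ω l = (n l : ℕ∞)} := by
  simp only [totalProgeny_eq_coe_iff, eventually_atTop, Set.ofPred_forall, Set.ofPred_exists]
  refine MeasurableSet.iInter fun l => MeasurableSet.iUnion fun a => MeasurableSet.iInter fun b =>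
    MeasurableSet.iInter fun _ => ?_
  have h1 : Measurable (partialProgeny X i b) := measurable_sum_nat _ fun k _ =>
    (measurable_generation i k).mono (offspringSigma_le hX _) le_rfl
  exact (measurable_pi_apply l).comp h1 (measurableSet_singleton (n l))

/-- Dominated convergence with bound `1`. Strictness `s l < 1` makes the monomial tend to `0` where
`T l = ∞`, matching the convention that such outcomes do not contribute. -/
theorem tendsto_lintegral_partialProgeny [IsProbabilityMeasure μ]
    (hX : ∀ k n j, Measurable (X k n j)) (i : Fin m) {s : Fin m → ℝ≥0∞} (hs : ∀ l, s l < 1) :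
    Tendsto (fun N => ∫⁻ ω, monomial s (partialProgeny X i N ω) ∂μ) atTop
      (𝓝 (∑' n : Fin m → ℕ, μ {ω | ∀ l, totalProgeny X i ω l = (n l : ℕ∞)} * monomial s n)) := by
  rw [← lintegral_tsum_indicator (measurableSet_totalProgeny_eq hX i)]
  refine tendsto_lintegral_of_dominated_convergence (fun _ => 1) (fun N => ?_) (fun N => ?_)
    (by simp) (ae_of_all _ fun ω => ?_)
  · exact (measurable_of_discrete_monomial s).comp (measurable_sum_nat _ fun k _ =>
      (measurable_generation i k).mono (offspringSigma_le hX _) le_rfl)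
  · exact ae_of_all _ fun ω => monomial_le_one (fun l => (hs l).le) _
  by_cases hfin : ∀ l, totalProgeny X i ω l ≠ ⊤
  · have hn : ∀ l, totalProgeny X i ω l = ((totalProgeny X i ω l).toNat : ℕ∞) := fun l =>
      (ENat.natCast_toNat (hfin l)).symm
    rw [tsum_indicator_eq_monomial hn]
    refine tendsto_const_nhds.congr' ?_
    have : ∀ᶠ N in atTop, ∀ l, partialProgeny X i N ω l = (totalProgeny X i ω l).toNat :=
      eventually_all.2 fun l => (totalProgeny_eq_coe_iff i ω l _).1 (hn l)
    filter_upwards [this] with N hN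
    rw [show partialProgeny X i N ω = fun l => (totalProgeny X i ω l).toNat from funext hN]
  · push Not at hfin
    obtain ⟨l, hl⟩ := hfin
    have h0 : ∑' k : Fin m → ℕ, {ω | ∀ i', totalProgeny X i ω i' = (k i' : ℕ∞)}.indicator 1 ω
        * monomial s k = 0 := by
      refine ENNReal.tsum_eq_zero.2 fun k => ?_
      rw [Set.indicator_of_notMem, zero_mul]
      intro hk
      have := hk l
      rw [hl] at this
      exact ENat.top_ne_natCast _ this
    rw [h0]
    have ht := tendsto_partialProgeny (X := X) i ω l
    rw [hl, ENat.tendsto_nhds_top_iff_natCast_lt] at ht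
    have hat : Tendsto (fun N => partialProgeny X i N ω l) atTop atTop :=
      tendsto_atTop.2 fun b => (ht b).mono fun N hN => by exact_mod_cast hN.le
    refine tendsto_of_tendsto_of_tendsto_of_le_of_le tendsto_const_nhds
      ((ENNReal.tendsto_pow_atTop_nhds_zero_of_lt_one (hs l)).comp hat) (fun N => zero_le)
      fun N => ?_
    rw [monomial, ← Finset.mul_prod_erase _ _ (Finset.mem_univ l)]
    exact mul_le_of_le_one_right' (Finset.prod_le_one' fun l' _ => pow_le_one' (hs l').le _)

variable {G : Fin m → (Fin m → ℝ) → ℝ}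

theorem IsOffspringFamily.ofReal_pgf [IsProbabilityMeasure μ] (h : IsOffspringFamily μ X G)
    {s : Fin m → ℝ} (hs : ∀ l, 0 ≤ s l ∧ s l ≤ 1) (k : Fin m) (n j : ℕ) :
    ∫⁻ ω, monomial (fun l => ENNReal.ofReal (s l)) (X k n j ω) ∂μ = ENNReal.ofReal (G k s) := by
  rw [← h.pgf_eq k n j s hs, ofReal_pgf_coe_eq_lintegral (h.measurable k n j) hs]

theorem IsOffspringFamily.mem_unitInterval [IsProbabilityMeasure μ] (h : IsOffspringFamily μ X G)
    {s : Fin m → ℝ} (hs : ∀ l, 0 ≤ s l ∧ s l ≤ 1) (k : Fin m) : 0 ≤ G k s ∧ G k s ≤ 1 := by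
  rw [← h.pgf_eq k 0 0 s hs]
  exact ⟨pgf_nonneg fun l => (hs l).1,
    pgf_le_one (measurableSet_forall_coe_eq (h.measurable k 0 0)) hs⟩

/-- The iterates of `v ↦ s G(v)`, started at `s`. -/
def progenyIterate (G : Fin m → (Fin m → ℝ) → ℝ) (s : Fin m → ℝ) : ℕ → Fin m → ℝ
  | 0 => s
  | N + 1 => fun k => s k * G k (progenyIterate G s N)

theorem IsOffspringFamily.progenyIterate_mem [IsProbabilityMeasure μ]
    (h : IsOffspringFamily μ X G) {s : Fin m → ℝ} (hs : ∀ l, 0 ≤ s l ∧ s l ≤ 1) (N : ℕ)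
    (l : Fin m) : 0 ≤ progenyIterate G s N l ∧ progenyIterate G s N l ≤ 1 := by
  induction N generalizing l with
  | zero => exact hs l
  | succ N ih =>
    have := h.mem_unitInterval ih l
    exact ⟨mul_nonneg (hs l).1 this.1, mul_le_one₀ (hs l).2 this.1 this.2⟩

theorem IsOffspringFamily.tendsto_progenyIterate [IsProbabilityMeasure μ]
    (h : IsOffspringFamily μ X G) {s : Fin m → ℝ} (hs : ∀ l, 0 ≤ s l ∧ s l < 1) (i : Fin m) :
    Tendsto (fun N => progenyIterate G s N i) atTop (𝓝 (pgf μ (totalProgeny X i) s)) := by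
  have hs' : ∀ l, 0 ≤ s l ∧ s l ≤ 1 := fun l => ⟨(hs l).1, (hs l).2.le⟩
  have hmem := h.progenyIterate_mem hs'
  have hiter : ∀ N, ENNReal.ofReal (progenyIterate G s N i)
      = ∫⁻ ω, monomial (fun l => ENNReal.ofReal (s l)) (partialProgeny X i (N + 1) ω) ∂μ := by
    intro N
    -- Take `n = 0`: the partial progeny is empty and `Z₀ = e_i`, so iterate `N` corresponds to `N +
    -- 1` generations.
    have := lintegral_monomial_partialProgeny h.measurable h.indep i
      (g := fun N l => ENNReal.ofReal (progenyIterate G s N l))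
      (G := fun N l => ENNReal.ofReal (G l (progenyIterate G s N)))
      (s := fun l => ENNReal.ofReal (s l)) rfl (fun N k n j => h.ofReal_pgf (hmem N) k n j)
      (fun N => funext fun k => ENNReal.ofReal_mul (hs k).1) N 0
    rw [zero_add] at this
    rw [← this]
    simp [partialProgeny, generation, monomial_zero, monomial_single]
  have hlim := (tendsto_lintegral_partialProgeny (μ := μ) h.measurable i
    (s := fun l => ENNReal.ofReal (s l)) fun l => by
      rw [ENNReal.ofReal_lt_one]; exact (hs l).2).comp (tendsto_add_atTop_nat 1)
  rw [← ofReal_pgf_eq_tsum (measurableSet_totalProgeny_eq h.measurable i) hs'] at hlim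
  have h2 := (ENNReal.tendsto_toReal ENNReal.ofReal_ne_top).comp hlim
  rw [ENNReal.toReal_ofReal (pgf_nonneg fun l => (hs l).1)] at h2
  refine h2.congr fun N => ?_
  simp only [Function.comp_apply]
  rw [← hiter, ENNReal.toReal_ofReal (hmem N i).1]

/-- The generating functions of the total progeny satisfy `G_T(s) = s G_X(G_T(s))`. -/
theorem IsOffspringFamily.pgf_totalProgeny [IsProbabilityMeasure μ]
    (h : IsOffspringFamily μ X G) (hG : ∀ k, Continuous (G k)) {s : Fin m → ℝ}
    (hs : ∀ l, 0 ≤ s l ∧ s l ≤ 1) (i : Fin m) :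
    pgf μ (totalProgeny X i) s = s i * G i fun l => pgf μ (totalProgeny X l) s := by
  have key : ∀ s : Fin m → ℝ, (∀ l, 0 ≤ s l ∧ s l < 1) →
      pgf μ (totalProgeny X i) s = s i * G i fun l => pgf μ (totalProgeny X l) s := by
    intro s hs
    have h1 := (h.tendsto_progenyIterate hs i).comp (tendsto_add_atTop_nat 1)
    have h2 : Tendsto (fun N => progenyIterate G s N) atTop
        (𝓝 fun l => pgf μ (totalProgeny X l) s) :=
      tendsto_pi_nhds.2 fun l => h.tendsto_progenyIterate hs l
    exact tendsto_nhds_unique h1 ((((hG i).tendsto _).comp h2).const_mul (s i))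
  -- Points with some `s l = 1` are reached along `a j * s`, which stays in `[0,1)^m`.
  set a : ℕ → ℝ := fun j => 1 - 1 / ((j : ℝ) + 1)
  have ha0 : ∀ j, 0 ≤ a j := fun j => by
    have : 1 / ((j : ℝ) + 1) ≤ 1 := by
      rw [div_le_one (by positivity)]
      linarith [(Nat.cast_nonneg j : (0 : ℝ) ≤ j)]
    simp only [a]; linarith
  have ha1 : ∀ j, a j < 1 := fun j => by
    have : 0 < 1 / ((j : ℝ) + 1) := by positivity
    simp only [a]; linarith
  have ha : Tendsto a atTop (𝓝 1) := by
    simpa [a] using tendsto_one_div_add_atTop_nhds_zero_nat.const_sub (1 : ℝ)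
  have hlt : ∀ j l, 0 ≤ a j * s l ∧ a j * s l < 1 := fun j l =>
    ⟨mul_nonneg (ha0 j) (hs l).1, (mul_le_of_le_one_right (ha0 j) (hs l).2).trans_lt (ha1 j)⟩
  have has : Tendsto (fun j l => a j * s l) atTop (𝓝 s) :=
    tendsto_pi_nhds.2 fun l => by simpa using ha.mul_const (s l)
  have has' : Tendsto (fun j l => a j * s l) atTop (𝓝[{s | ∀ l, 0 ≤ s l ∧ s l ≤ 1}] s) :=
    tendsto_nhdsWithin_iff.2 ⟨has, Eventually.of_forall fun j l => ⟨(hlt j l).1, (hlt j l).2.le⟩⟩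
  have hT : ∀ l, Tendsto (fun j => pgf μ (totalProgeny X l) fun l => a j * s l) atTop
      (𝓝 (pgf μ (totalProgeny X l) s)) := fun l =>
    (continuousOn_pgf (measurableSet_totalProgeny_eq h.measurable l) s hs).tendsto.comp has'
  refine tendsto_nhds_unique (hT i) ?_
  have h3 := ((tendsto_pi_nhds.1 has) i).mul
    (((hG i).tendsto _).comp (tendsto_pi_nhds.2 hT))
  exact h3.congr fun j => (key _ (hlt j)).symm

/-! ### Mean offspring numbers -/

/-- The mean of a random variable whose generating function is that of a Poisson law. -/
theorem integral_of_poisson_pgf [IsProbabilityMeasure μ] {Y : Ω → ℕ} (hY : Measurable Y) {c : ℝ}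
    (hc : 0 ≤ c) (h : ∀ σ : ℝ, 0 ≤ σ → σ < 1 →
      ∫⁻ ω, ENNReal.ofReal σ ^ Y ω ∂μ = ENNReal.ofReal (Real.exp (c * (σ - 1)))) :
    ∫ ω, (Y ω : ℝ) ∂μ = c := by
  set a : ℕ → ℝ := fun j => 1 / ((j : ℝ) + 1)
  have ha0 : ∀ j, 0 < a j := fun j => by simp only [a]; positivity
  have ha1 : ∀ j, a j ≤ 1 := fun j => by
    simp only [a]
    rw [div_le_one (by positivity)]
    linarith [(Nat.cast_nonneg j : (0 : ℝ) ≤ j)]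
  have haanti : Antitone a := fun i j hij => by
    simp only [a]
    gcongr
  have ha : Tendsto a atTop (𝓝 0) := tendsto_one_div_add_atTop_nhds_zero_nat
  -- The geometric sum is `(1 - σ^Y)/(1 - σ)` at `σ = 1 - a j`. It increases to `Y` as `a j → 0`, so
  -- monotone convergence yields the mean without prior integrability.
  have hint : ∀ j, ∫⁻ ω, ENNReal.ofReal (∑ k ∈ Finset.range (Y ω), (1 - a j) ^ k) ∂μ
      = ENNReal.ofReal ((1 - Real.exp (-(c * a j))) / a j) := by
    intro j
    have hσ0 : 0 ≤ 1 - a j := by linarith [ha1 j]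
    have hmeas : Measurable fun ω => ENNReal.ofReal (∑ k ∈ Finset.range (Y ω), (1 - a j) ^ k) :=
      (measurable_of_countable fun n : ℕ =>
        ENNReal.ofReal (∑ k ∈ Finset.range n, (1 - a j) ^ k)).comp hY
    have hE : ENNReal.ofReal (a j) *
        ∫⁻ ω, ENNReal.ofReal (∑ k ∈ Finset.range (Y ω), (1 - a j) ^ k) ∂μ
        + ENNReal.ofReal (Real.exp (-(c * a j))) = 1 := by
      have h1 := h (1 - a j) hσ0 (by linarith [ha0 j])
      rw [show c * (1 - a j - 1) = -(c * a j) by ring] at h1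
      rw [← h1, ← lintegral_const_mul _ hmeas, ← lintegral_add_left (hmeas.const_mul _)]
      rw [show (1 : ℝ≥0∞) = ∫⁻ _, 1 ∂μ by simp]
      refine lintegral_congr fun ω => ?_
      have hg := mul_neg_geom_sum (1 - a j) (Y ω)
      rw [sub_sub_cancel] at hg
      rw [← ENNReal.ofReal_mul (ha0 j).le, ← ENNReal.ofReal_pow hσ0, hg,
        ← ENNReal.ofReal_add (sub_nonneg.2 (pow_le_one₀ hσ0 (by linarith [ha0 j])))
          (pow_nonneg hσ0 _)]
      simp
    have hexp : Real.exp (-(c * a j)) ≤ 1 :=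
      Real.exp_le_one_iff.2 (by have := mul_nonneg hc (ha0 j).le; linarith)
    have h2 : ENNReal.ofReal (a j) *
        ∫⁻ ω, ENNReal.ofReal (∑ k ∈ Finset.range (Y ω), (1 - a j) ^ k) ∂μ
        = ENNReal.ofReal (1 - Real.exp (-(c * a j))) := by
      rw [ENNReal.ofReal_sub _ (Real.exp_pos _).le, ENNReal.ofReal_one]
      exact ENNReal.eq_sub_of_add_eq ENNReal.ofReal_ne_top hE
    rw [ENNReal.ofReal_div_of_pos (ha0 j), ← h2, mul_comm,
      ENNReal.mul_div_cancel_right (by simpa using ha0 j) ENNReal.ofReal_ne_top]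
  have hlim1 : Tendsto (fun j => ∫⁻ ω,
      ENNReal.ofReal (∑ k ∈ Finset.range (Y ω), (1 - a j) ^ k) ∂μ) atTop
      (𝓝 (∫⁻ ω, ENNReal.ofReal (Y ω) ∂μ)) := by
    refine lintegral_tendsto_of_tendsto_of_monotone (fun j => ?_) (ae_of_all _ fun ω => ?_)
      (ae_of_all _ fun ω => ?_)
    · exact ((measurable_of_countable fun n : ℕ =>
        ENNReal.ofReal (∑ k ∈ Finset.range n, (1 - a j) ^ k)).comp hY).aemeasurable
    · intro i j hij
      refine ENNReal.ofReal_le_ofReal (Finset.sum_le_sum fun k _ => ?_)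
      exact pow_le_pow_left₀ (by linarith [ha1 i]) (by linarith [haanti hij]) k
    · refine ENNReal.tendsto_ofReal ?_
      have : Tendsto (fun j => ∑ k ∈ Finset.range (Y ω), (1 - a j) ^ k) atTop
          (𝓝 (∑ k ∈ Finset.range (Y ω), (1 - 0) ^ k)) :=
        tendsto_finsetSum _ fun k _ => (ha.const_sub 1).pow k
      simpa using this
  have hlim2 : Tendsto (fun j => (1 - Real.exp (-(c * a j))) / a j) atTop (𝓝 c) := by
    have hd : HasDerivAt (fun y : ℝ => -Real.exp (-(c * y))) c 0 := by
      have := (((hasDerivAt_id (0 : ℝ)).const_mul c).fun_neg.exp).fun_neg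
      simpa using this
    have hs := hd.tendsto_slope_zero.comp
      (tendsto_nhdsWithin_iff.2 ⟨ha, Eventually.of_forall fun j => (ha0 j).ne'⟩)
    refine hs.congr fun j => ?_
    simp only [Function.comp_apply, zero_add, mul_zero, neg_zero, Real.exp_zero, smul_eq_mul]
    field_simp
    ring
  have hL : ∫⁻ ω, ENNReal.ofReal (Y ω) ∂μ = ENNReal.ofReal c :=
    tendsto_nhds_unique hlim1 ((ENNReal.tendsto_ofReal hlim2).congr fun j => (hint j).symm)
  rw [integral_eq_lintegral_of_nonneg_ae (ae_of_all _ fun ω => Nat.cast_nonneg _)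
    (measurable_from_top.comp hY).aestronglyMeasurable, hL, ENNReal.toReal_ofReal hc]

variable {A : Matrix (Fin m) (Fin m) ℝ} {p : Fin m → ℝ}

theorem meanMatrix_eq [IsProbabilityMeasure μ] {t : ℝ} (ht : 0 ≤ t) (hA0 : ∀ i j, 0 ≤ A i j)
    (hp : ∀ i, 0 ≤ p i) (h : IsOffspringFamily μ X (poissonOffspring A p t)) :
    meanMatrix μ X = t • (A * Matrix.diagonal p) := by
  ext k l
  simp only [meanMatrix, Matrix.of_apply, Matrix.smul_apply, Matrix.mul_diagonal, smul_eq_mul]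
  refine integral_of_poisson_pgf ((measurable_pi_apply l).comp (h.measurable k 0 0))
    (mul_nonneg ht (mul_nonneg (hA0 k l) (hp l))) fun σ hσ0 hσ1 => ?_
  -- Setting all variables but the `l`-th to `1` isolates the marginal law of the `l`-th component.
  have hs : ∀ j, 0 ≤ Function.update (1 : Fin m → ℝ) l σ j ∧
      Function.update (1 : Fin m → ℝ) l σ j ≤ 1 := by
    intro j
    by_cases hj : j = l
    · subst hj; simp [hσ0, hσ1.le]
    · simp [hj]
  have h1 := h.ofReal_pgf hs k 0 0
  have h2 : poissonOffspring A p t k (Function.update (1 : Fin m → ℝ) l σ)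
      = Real.exp (t * (A k l * p l) * (σ - 1)) := by
    rw [poissonOffspring, Finset.prod_eq_single l]
    · simp [mul_assoc]
    · intro j _ hj
      simp [hj]
    · simp
  rw [h2] at h1
  rw [← h1]
  refine lintegral_congr fun ω => ?_
  rw [monomial, Finset.prod_eq_single l]
  · simp
  · intro j _ hj
    simp [hj]
  · simp

end TotalProgeny

end Coagulation

namespace Coagulation

/-! ### Monodisperse initial conditions -/

section Monodisperse

variable {m : ℕ} {w : (Fin m → ℕ) → ℝ}

theorem single_one_injective : Function.Injective fun i : Fin m => (Pi.single i 1 : Fin m → ℕ) := by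
  intro i j h
  by_contra hij
  have := congrFun h i
  simp [hij] at this

theorem IsMonodisperse.tsum_eq (hw : IsMonodisperse w) (f : (Fin m → ℕ) → ℝ) :
    ∑' n, f n * w n = ∑ i, f (Pi.single i 1) * w (Pi.single i 1) := by
  classical
  rw [tsum_eq_sum (s := Finset.univ.image fun i : Fin m => (Pi.single i 1 : Fin m → ℕ)),
    Finset.sum_image fun i _ j _ h => single_one_injective h]
  intro n hn
  by_contra hne
  obtain ⟨i, rfl⟩ := hw.support n (right_ne_zero_of_mul hne)
  exact hn (Finset.mem_image_of_mem _ (Finset.mem_univ i))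

theorem IsMonodisperse.massVector_apply (hw : IsMonodisperse w) (i : Fin m) :
    massVector w i = w (Pi.single i 1) := by
  rw [massVector, hw.tsum_eq fun n => (n i : ℝ), Finset.sum_eq_single i]
  · simp
  · intro j _ hj
    simp [hj.symm]
  · simp

theorem IsMonodisperse.genFun_apply (hw : IsMonodisperse w) (x : Fin m → ℝ) :
    genFun w x = ∑ i, w (Pi.single i 1) * Real.exp (-x i) := by
  have : genFun w x = ∑' n, Real.exp (-∑ j, x j * (n j : ℝ)) * w n :=
    tsum_congr fun n => mul_comm _ _
  rw [this, hw.tsum_eq]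
  refine Finset.sum_congr rfl fun i _ => ?_
  rw [Finset.sum_eq_single i, mul_comm]
  · simp
  · intro j _ hj
    simp [hj]
  · simp

/-- For `m = 0` every `|n|` is an empty sum, so the total mass could not be `1`. -/
theorem IsMonodisperse.neZero (hw : IsMonodisperse w) : NeZero m := by
  constructor
  rintro rfl
  have h : HasSum (fun n : Fin 0 → ℕ => (∑ i, (n i : ℝ)) * w n) 0 := by
    simp
  exact one_ne_zero (hw.mass.unique h)

end Monodisperse

/-! ### The fixed point equation for Poisson offspring -/

section Poisson

variable {m : ℕ} {A : Matrix (Fin m) (Fin m) ℝ} {p : Fin m → ℝ}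

theorem continuous_poissonOffspring (t : ℝ) (k : Fin m) :
    Continuous (poissonOffspring A p t k) := by
  unfold poissonOffspring
  fun_prop

theorem exp_neg_mul_poissonOffspring (t : ℝ) (x h : Fin m → ℝ) (i : Fin m) :
    Real.exp (-x i) * poissonOffspring A p t i h = progenyMap A p t x h i := by
  rw [poissonOffspring, progenyMap, ← Real.exp_sum, ← Real.exp_add, Finset.mul_sum]
  congr 2
  exact Finset.sum_congr rfl fun l _ => by ring

theorem exp_neg_mem_unitInterval {x : Fin m → ℝ} (hx : x ∈ orthant m) (l : Fin m) :
    0 ≤ Real.exp (-x l) ∧ Real.exp (-x l) ≤ 1 :=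
  ⟨(Real.exp_pos _).le, Real.exp_le_one_iff.2 (neg_nonpos.2 (hx l))⟩

theorem pgf_totalProgeny_eq_progenyMap {Ω : Type*} [MeasurableSpace Ω] {μ : Measure Ω}
    [IsProbabilityMeasure μ] {X : Fin m → ℕ → ℕ → Ω → Fin m → ℕ} {t : ℝ}
    (h : IsOffspringFamily μ X (poissonOffspring A p t)) {x : Fin m → ℝ} (hx : x ∈ orthant m) :
    (fun i => pgf μ (totalProgeny X i) fun j => Real.exp (-x j))
      = progenyMap A p t x fun i => pgf μ (totalProgeny X i) fun j => Real.exp (-x j) := by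
  ext i
  rw [← exp_neg_mul_poissonOffspring]
  exact h.pgf_totalProgeny (continuous_poissonOffspring t) (exp_neg_mem_unitInterval hx) i

end Poisson

/-! ### Comparison of `t` with the critical time -/

section CriticalTime

variable {m : ℕ} [NeZero m] {A : Matrix (Fin m) (Fin m) ℝ} {p : Fin m → ℝ} {t : ℝ}

theorem ofReal_lt_criticalTime_iff (ht : 0 ≤ t) : ENNReal.ofReal t < criticalTime A p ↔
    t * (specRadius (A * Matrix.diagonal p)).toReal < 1 := by
  rw [criticalTime, ← one_div, ENNReal.lt_div_iff_mul_lt (Or.inr ENNReal.ofReal_ne_top)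
    (Or.inl (specRadius_ne_top _))]
  nth_rw 1 [← ENNReal.ofReal_toReal (specRadius_ne_top (A * Matrix.diagonal p))]
  rw [← ENNReal.ofReal_mul ht, ENNReal.ofReal_lt_one]

/-- If the spectral radius is `0`, both sides fail: the critical time is infinite and the product is
`0`. -/
theorem ofReal_eq_criticalTime_iff : ENNReal.ofReal t = criticalTime A p ↔
    ENNReal.ofReal t * specRadius (A * Matrix.diagonal p) = 1 := by
  rw [criticalTime]
  constructor
  · intro h
    rw [h]
    refine ENNReal.inv_mul_cancel (fun h0 => ?_) (specRadius_ne_top _)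
    rw [h0, ENNReal.inv_zero] at h
    exact ENNReal.ofReal_ne_top h
  · exact ENNReal.eq_inv_of_mul_eq_one_left

end CriticalTime

end Coagulation

theorem theorem2 {m : ℕ} (A : Matrix (Fin m) (Fin m) ℝ) (hA_symm : A.IsSymm)
    (hA_irr : A.IsIrreducible)
    (w₀ : (Fin m → ℕ) → ℝ) (hw₀ : Coagulation.IsMonodisperse w₀)
    (p : Fin m → ℝ) (hp : ∀ i, p i = w₀ (Pi.single i 1))
    {Ω : ℝ → Type*} [∀ t, MeasurableSpace (Ω t)] (μ : ∀ t, Measure (Ω t))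
    [∀ t, IsProbabilityMeasure (μ t)]
    (X : ∀ t, Fin m → ℕ → ℕ → Ω t → Fin m → ℕ)
    (hX : ∀ t : ℝ, 0 ≤ t → Coagulation.IsOffspringFamily (μ t) (X t)
      (Coagulation.poissonOffspring A p t))
    (u : ℝ → (Fin m → ℝ) → Fin m → ℝ) (hu : u = Coagulation.solution μ X p)
    (Tc : ℝ≥0∞) (hTc : Tc = Coagulation.criticalTime A p) :
    -- `u` solves the equation, with its initial condition, before `Tc`
    (∀ t : ℝ, 0 ≤ t → ENNReal.ofReal t < Tc → ∀ x ∈ Coagulation.orthant m,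
      Coagulation.SolvesBurgersAt A (Coagulation.massVector w₀) u t x) ∧
    (∀ x ∈ Coagulation.orthant m,
      Coagulation.IsNegGradientAt (Coagulation.genFun w₀) (u 0 x) x) ∧
    -- `u` is smooth, jointly in `(t, x)`, up to `Tc`
    ContDiffOn ℝ ((⊤ : ℕ∞) : WithTop ℕ∞) (fun q : ℝ × (Fin m → ℝ) => u q.1 q.2)
      {q | 0 ≤ q.1 ∧ ENNReal.ofReal q.1 < Tc ∧ q.2 ∈ Coagulation.orthant m} ∧
    -- `u` is no longer smooth at `Tc`
    (∀ t : ℝ, 0 ≤ t → ENNReal.ofReal t = Tc →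
      ¬ DifferentiableWithinAt ℝ (u t) (Coagulation.orthant m) 0) ∧
    -- `Tc` is the time at which the branching process is critical
    (∀ t : ℝ, 0 ≤ t → (Coagulation.IsCritical (μ t) (X t) ↔ ENNReal.ofReal t = Tc)) ∧
    -- `Tc` is positive, and not smaller than the inverse of the Euclidean operator norm of `A P`
    0 < Tc ∧
    (‖Matrix.toEuclideanCLM (𝕜 := ℝ) (A * Matrix.diagonal p)‖ₑ)⁻¹ ≤ Tc := by
  have := hw₀.neZero
  have hA0 := hA_irr.nonneg
  have hp0 : ∀ i, 0 ≤ p i := fun i => by rw [hp]; exact hw₀.nonneg _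
  have hmass : Coagulation.massVector w₀ = p :=
    funext fun i => by rw [hw₀.massVector_apply, hp]
  set H : ℝ → (Fin m → ℝ) → Fin m → ℝ := fun t x i =>
    Coagulation.pgf (μ t) (Coagulation.totalProgeny (X t) i) fun j => Real.exp (-x j)
  have hu' : u = fun t x i => p i * H t x i := hu
  have hH : ∀ t, 0 ≤ t → ∀ x ∈ Coagulation.orthant m,
      H t x = Coagulation.progenyMap A p t x (H t x) := fun t ht x hx =>
    Coagulation.pgf_totalProgeny_eq_progenyMap (hX t ht) hx
  have hH1 : ∀ t, 0 ≤ t → ∀ x ∈ Coagulation.orthant m, ∀ i, H t x i ≤ 1 :=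
    fun t ht x hx i => Coagulation.pgf_le_one
      (Coagulation.measurableSet_totalProgeny_eq (hX t ht).measurable i)
      (Coagulation.exp_neg_mem_unitInterval hx)
  subst hTc hu'
  rw [hmass]
  refine ⟨fun t ht htT x hx => ?_, fun x hx => ?_, ?_, fun t ht htT => ?_, fun t ht => ?_, ?_, ?_⟩
  · exact Coagulation.solvesBurgersAt_fixedPoint hA_symm hA0 hp0 hH hH1 ht
      ((Coagulation.ofReal_lt_criticalTime_iff ht).1 htT) hx
  -- At `t = 0` the right-hand side of the fixed point equation no longer involves `h`.
  · have hx0 : ∀ i, p i * H 0 x i = p i * Real.exp (-x i) := fun i => by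
      rw [hH 0 le_rfl x hx]
      simp [Coagulation.progenyMap]
    have hgen : Coagulation.genFun w₀ = fun x => ∑ i, p i * Real.exp (-x i) := by
      ext x
      rw [hw₀.genFun_apply]
      simp [hp]
    have hd : HasFDerivAt (fun x : Fin m → ℝ => ∑ i, p i * Real.exp (-x i))
        (∑ i, p i • Real.exp (-x i) •
          -ContinuousLinearMap.proj (R := ℝ) (φ := fun _ : Fin m => ℝ) i) x :=
      HasFDerivAt.fun_sum fun i _ => ((hasFDerivAt_apply i x).fun_neg.exp).const_mul (p i)
    rw [Coagulation.IsNegGradientAt, hgen]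
    convert hd.hasFDerivWithinAt using 1
    simp only [hx0, mul_smul, smul_neg, Finset.sum_neg_distrib]
  · have := Coagulation.contDiffOn_fixedPoint hA_symm hA0 hp0 hH hH1
    refine this.congr_mono (fun q _ => rfl) ?_
    rintro q ⟨h1, h2, h3⟩
    exact ⟨h1, (Coagulation.ofReal_lt_criticalTime_iff h1).1 h2, h3⟩
  · have h1 := congrArg ENNReal.toReal (Coagulation.ofReal_eq_criticalTime_iff.1 htT)
    rw [ENNReal.toReal_mul, ENNReal.toReal_ofReal ht, ENNReal.toReal_one] at h1
    exact Coagulation.not_differentiableWithinAt_fixedPoint hA_symm hA0 hp0 h1 (hH t ht)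
  · rw [Coagulation.IsCritical, Coagulation.meanMatrix_eq ht hA0 hp0 (hX t ht),
      Coagulation.specRadius_smul ht, Coagulation.ofReal_eq_criticalTime_iff]
  · exact ENNReal.inv_pos.2 (Coagulation.specRadius_ne_top _)
  · exact ENNReal.inv_le_inv.2 (Coagulation.specRadius_mul_diagonal_le hA_symm hA0 hp0)
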